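/- Model of computation: a real RAM, i.e. a uniform program with arrays of natural numbers (addition, truncated subtraction, comparison) and arrays of real numbers (addition, subtraction, multiplication, comparison, integer constants), indirect addressing, and unit cost per operation. (i) Stabbing pairwise disjoint closed axis-parallel unit squares with $k$ axis-parallel lines is fixed-parameter tractable with respect to $k$: there are a program (which uses no multiplication), a computable function $f$ and a constant $e$ such that, given $n$, $k$ and the lower left corners of $n$ pairwise disjoint closed axis-parallel unit squares in the plane, the program decides in at most $f(k)\,(n+1)^e$ steps whether there are at most $k$ axis-parallel lines such that each of the squares is met by at least one of them. (ii) Let $\mathcal D$ be a set of $r\ge 1$ distinct directions in the plane. A $\mathcal D$-line is a line whose direction belongs to $\mathcal D$. For $c\ge 1$, a family of sets in the plane is called $c$-shallow for $\mathcal D$ if any two $\mathcal D$-lines with different directions simultaneously meet at most $c$ members of the family. There are a single program and an absolute constant $C$ such that the following holds for all integers $n\ge 0$ and $k,c,r\ge 1$, every set $\mathcal D$ of $r$ directions, every nonempty compact connected set $O\subset\mathbb R^2$ and all $v_1,\dots,v_n\in\mathbb R^2$ for which the family of translates $v_1+O,\dots,v_n+O$ is $c$-shallow for $\mathcal D$.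 Given $n,k,c,r$, a direction vector $d\neq 0$ for each direction in $\mathcal D$, the minimum and the maximum over $x\in O$ of $d_1x_2-d_2x_1$ for each of these vectors (which describe the two extreme lines of that direction that meet $O$), and the vectors $v_1,\dots,v_n$, the program decides whether there are at most $k$ $\mathcal D$-lines such that each translate is met by at least one of them; and if $n\ge 2$, it does so in at most $$C\,(2rck)^{2k+2}\, r\, n\log n$$ steps. In particular, for constant $r$ and $c$ and each fixed $k$ the running time is $O(n\log n)$. -/

import Mathlib

/-! A real RAM, given as a small structured programming language with a step count.
The memory consists of arrays of natural numbers and arrays of real numbers; entries are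
addressed indirectly, by computed natural numbers. Natural numbers (addresses, counters) may be
added, subtracted and compared; real numbers may be added, subtracted, multiplied and compared.
There is no conversion between the two kinds, no rounding, and no arbitrary real constant.
Every operation, memory access and test costs one step. -/

namespace RealRAM

/-- A memory: `nat a i` is entry `i` of the `a`-th array of natural numbers, and `real a i` is
entry `i` of the `a`-th array of real numbers. -/
structure State where
  nat : ℕ → ℕ → ℕ
  real : ℕ → ℕ → ℝ

/-- Overwrite entry `i` of the `a`-th array of natural numbers. -/
def State.setNat (s : State) (a i v : ℕ) : State :=
  { s with nat := Function.update s.nat a (Function.update (s.nat a) i v) }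

/-- Overwrite entry `i` of the `a`-th array of real numbers. -/
noncomputable def State.setReal (s : State) (a i : ℕ) (v : ℝ) : State :=
  { s with real := Function.update s.real a (Function.update (s.real a) i v) }

/-- Expressions for natural numbers; `sub` is truncated subtraction. -/
inductive NExp where
  | const (m : ℕ)
  | read (a : ℕ) (i : NExp)
  | add (x y : NExp)
  | sub (x y : NExp)

/-- Expressions for real numbers. -/
inductive RExp where
  | const (m : ℤ)
  | read (a : ℕ) (i : NExp)
  | add (x y : RExp)
  | sub (x y : RExp)
  | mul (x y : RExp)

/-- Tests. -/
inductive BExp where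
  | natLe (x y : NExp)
  | realLe (x y : RExp)
  | not (b : BExp)
  | and (b c : BExp)

/-- Programs. -/
inductive Cmd where
  | skip
  | setNat (a : ℕ) (i x : NExp)
  | setReal (a : ℕ) (i : NExp) (x : RExp)
  | seq (p q : Cmd)
  | ite (b : BExp) (p q : Cmd)
  | loop (b : BExp) (p : Cmd)

/-- The value of an expression. -/
def NExp.eval (s : State) : NExp → ℕ
  | const m => m
  | read a i => s.nat a (i.eval s)
  | add x y => x.eval s + y.eval s
  | sub x y => x.eval s - y.eval s

/-- The number of steps needed to evaluate an expression. -/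
def NExp.cost : NExp → ℕ
  | const _ => 1
  | read _ i => i.cost + 1
  | add x y => x.cost + y.cost + 1
  | sub x y => x.cost + y.cost + 1

/-- The value of an expression. -/
noncomputable def RExp.eval (s : State) : RExp → ℝ
  | const m => m
  | read a i => s.real a (i.eval s)
  | add x y => x.eval s + y.eval s
  | sub x y => x.eval s - y.eval s
  | mul x y => x.eval s * y.eval s

/-- The number of steps needed to evaluate an expression. -/
def RExp.cost : RExp → ℕ
  | const _ => 1
  | read _ i => i.cost + 1
  | add x y => x.cost + y.cost + 1
  | sub x y => x.cost + y.cost + 1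
  | mul x y => x.cost + y.cost + 1

/-- The truth of a test. -/
def BExp.eval (s : State) : BExp → Prop
  | natLe x y => x.eval s ≤ y.eval s
  | realLe x y => x.eval s ≤ y.eval s
  | not b => ¬ b.eval s
  | and b c => b.eval s ∧ c.eval s

/-- The number of steps needed to evaluate a test. -/
def BExp.cost : BExp → ℕ
  | natLe x y => x.cost + y.cost + 1
  | realLe x y => x.cost + y.cost + 1
  | not b => b.cost + 1
  | and b c => b.cost + c.cost + 1

/-- `Run p s t s'`: started in the memory `s`, the program `p` halts after exactly `t` steps, in
the memory `s'`. -/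
inductive Run : Cmd → State → ℕ → State → Prop where
  | skip (s : State) : Run Cmd.skip s 1 s
  | setNat (s : State) (a : ℕ) (i x : NExp) :
      Run (Cmd.setNat a i x) s (i.cost + x.cost + 1) (s.setNat a (i.eval s) (x.eval s))
  | setReal (s : State) (a : ℕ) (i : NExp) (x : RExp) :
      Run (Cmd.setReal a i x) s (i.cost + x.cost + 1) (s.setReal a (i.eval s) (x.eval s))
  | seq {p q : Cmd} {s s' s'' : State} {t t' : ℕ} (hp : Run p s t s') (hq : Run q s' t' s'') :
      Run (Cmd.seq p q) s (t + t') s''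
  | ite_true {b : BExp} {p q : Cmd} {s s' : State} {t : ℕ} (hb : b.eval s) (hp : Run p s t s') :
      Run (Cmd.ite b p q) s (b.cost + t + 1) s'
  | ite_false {b : BExp} {p q : Cmd} {s s' : State} {t : ℕ} (hb : ¬ b.eval s)
      (hq : Run q s t s') : Run (Cmd.ite b p q) s (b.cost + t + 1) s'
  | loop_true {b : BExp} {p : Cmd} {s s' s'' : State} {t t' : ℕ} (hb : b.eval s)
      (hp : Run p s t s') (hl : Run (Cmd.loop b p) s' t' s'') :
      Run (Cmd.loop b p) s (b.cost + t + t' + 1) s''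
  | loop_false {b : BExp} {p : Cmd} {s : State} (hb : ¬ b.eval s) :
      Run (Cmd.loop b p) s (b.cost + 1) s

/-- The memory with the numbers `nats` in the entries `0` of the first arrays of natural numbers
and the lists `reals` in the first arrays of real numbers; every other entry is `0`. -/
def State.init (nats : List ℕ) (reals : List (List ℝ)) : State where
  nat a i := if i = 0 then nats.getD a 0 else 0
  real a i := (reals.getD a []).getD i 0

/-- Started in the memory `s`, the program `p` halts after exactly `t` steps and answers the
question whether `Q` holds, by a `1` or a `0` in entry `0` of array `0`. -/
def Cmd.Answers (p : Cmd) (s : State) (Q : Prop) (t : ℕ) : Prop :=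
  ∃ s', Run p s t s' ∧ (Q → s'.nat 0 0 = 1) ∧ (¬ Q → s'.nat 0 0 = 0)

/-- The expression contains no multiplication. -/
def RExp.MulFree : RExp → Prop
  | const _ => True
  | read _ _ => True
  | add x y => x.MulFree ∧ y.MulFree
  | sub x y => x.MulFree ∧ y.MulFree
  | mul _ _ => False

/-- The test contains no multiplication. -/
def BExp.MulFree : BExp → Prop
  | natLe _ _ => True
  | realLe x y => x.MulFree ∧ y.MulFree
  | not b => b.MulFree
  | and b c => b.MulFree ∧ c.MulFree

/-- The program contains no multiplication. -/
def Cmd.MulFree : Cmd → Prop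
  | skip => True
  | setNat _ _ _ => True
  | setReal _ _ x => x.MulFree
  | seq p q => p.MulFree ∧ q.MulFree
  | ite b p q => b.MulFree ∧ p.MulFree ∧ q.MulFree
  | loop b p => b.MulFree ∧ p.MulFree

/-- A parameterized decision problem with inputs for a real RAM. -/
structure ParamProblem where
  Inst : Type
  input : Inst → State
  size : Inst → ℕ
  param : Inst → ℕ
  yes : Inst → Prop

/-- A parameterized problem is fixed-parameter tractable if a program solves it in at most
`f k * N ^ e` steps on the instances of size `N` with parameter `k`, where `f` is a computable
function and `e` is a constant. The program must do without multiplication, so that on rational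
inputs the lengths of the numbers grow by at most a constant number of bits per step, and the
step count is polynomially related to the number of bit operations. -/
def FixedParameterTractable (X : ParamProblem) : Prop :=
  ∃ p : Cmd, p.MulFree ∧ ∃ f : ℕ → ℕ, Computable f ∧ ∃ e : ℕ,
    ∀ x : X.Inst, ∃ t : ℕ, p.Answers (X.input x) (X.yes x) t ∧
      t ≤ f (X.param x) * X.size x ^ e

end RealRAM

namespace Stabbing

/-- The Euclidean plane. -/
abbrev Plane : Type := EuclideanSpace ℝ (Fin 2)

/-- A line whose direction (a one-dimensional subspace) belongs to the set `D`. -/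
def IsDLine (D : Set (Submodule ℝ Plane)) (l : AffineSubspace ℝ Plane) : Prop :=
  (l : Set Plane).Nonempty ∧ l.direction ∈ D

/-- The set `A` is stabbed by the line `l`. -/
def Stabs (l : AffineSubspace ℝ Plane) (A : Set Plane) : Prop :=
  ((l : Set Plane) ∩ A).Nonempty

/-- All the sets `S j` can be stabbed by (at most) `k` lines with directions from `D`. -/
def Stabbable {ι : Type*} (D : Set (Submodule ℝ Plane)) (S : ι → Set Plane) (k : ℕ) : Prop :=
  ∃ L : Finset (AffineSubspace ℝ Plane), L.card ≤ k ∧ (∀ l ∈ L, IsDLine D l) ∧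
    ∀ j, ∃ l ∈ L, Stabs l (S j)

/-- Two lines with different directions from `D` simultaneously stab at most `c` of the sets. -/
def Shallow {ι : Type*} (c : ℕ) (D : Set (Submodule ℝ Plane)) (S : ι → Set Plane) : Prop :=
  ∀ l l' : AffineSubspace ℝ Plane, IsDLine D l → IsDLine D l' → l.direction ≠ l'.direction →
    {j | Stabs l (S j) ∧ Stabs l' (S j)}.encard ≤ c

/-- The set of the directions that are spanned by the vectors `d i`. -/
def directions {r : ℕ} (d : Fin r → Plane) : Set (Submodule ℝ Plane) :=
  Set.range fun i => Submodule.span ℝ {d i}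

/-- The translate of `O` by the vector `v`. -/
def translate (O : Set Plane) (v : Plane) : Set Plane := (fun x => v + x) '' O

/-- The linear functional whose level sets are the lines with direction vector `d`
(for `d ≠ 0`). -/
def level (d x : Plane) : ℝ := d 0 * x 1 - d 1 * x 0

/-- The closed axis-parallel unit square with lower left corner `a`. -/
def unitSquare (a : Plane) : Set Plane := {x | ∀ i, a i ≤ x i ∧ x i ≤ a i + 1}

/-- The two axis-parallel directions. -/
def axisParallel : Set (Submodule ℝ Plane) :=
  {Submodule.span ℝ {!₂[(1 : ℝ), 0]}, Submodule.span ℝ {!₂[(0 : ℝ), 1]}}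

/-- An instance of the problem to stab disjoint axis-parallel unit squares with `k`
axis-parallel lines. -/
structure SquareInstance where
  n : ℕ
  k : ℕ
  corner : Fin n → Plane
  disjoint : Pairwise fun i j => Disjoint (unitSquare (corner i)) (unitSquare (corner j))

/-- Stabbing `n` disjoint axis-parallel unit squares with `k` axis-parallel lines, with
parameter `k`. The input consists of `n`, `k` and the lower left corners of the squares. The size
is taken to be `n + 1`, so that `n = 0` is allowed. -/
def disjointUnitSquares : RealRAM.ParamProblem where
  Inst := SquareInstance
  input x := RealRAM.State.init [x.n, x.k]
    [List.ofFn fun j => x.corner j 0, List.ofFn fun j => x.corner j 1]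
  size x := x.n + 1
  param x := x.k
  yes x := Stabbable axisParallel (fun j => unitSquare (x.corner j)) x.k

/-- The input of the problem to stab the translates of an object by the vectors `v j` with `k`
lines with direction vectors `d i`, when the set of translates is `c`-shallow. The object is
described by its extent in each of the directions: the lines with direction vector `d i` that
meet it are those on which the value of `level (d i)` is between `lo i` and `hi i`. -/
noncomputable def translatesInput (n k c r : ℕ) (d : Fin r → Plane) (lo hi : Fin r → ℝ)
    (v : Fin n → Plane) : RealRAM.State :=
  RealRAM.State.init [n, k, c, r]
    [List.ofFn fun i => d i 0, List.ofFn fun i => d i 1, List.ofFn lo, List.ofFn hi,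
      List.ofFn fun j => v j 0, List.ofFn fun j => v j 1]

end Stabbing

namespace RealRAM

/-- The arrays of natural numbers that a program may change. -/
def Cmd.natWrites : Cmd → List ℕ
  | skip => []
  | setNat a _ _ => [a]
  | setReal _ _ _ => []
  | seq p q => p.natWrites ++ q.natWrites
  | ite _ p q => p.natWrites ++ q.natWrites
  | loop _ p => p.natWrites

/-- The arrays of real numbers that a program may change. -/
def Cmd.realWrites : Cmd → List ℕ
  | skip => []
  | setNat _ _ _ => []
  | setReal a _ _ => [a]
  | seq p q => p.realWrites ++ q.realWrites
  | ite _ p q => p.realWrites ++ q.realWrites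
  | loop _ p => p.realWrites

/-- The memory `s'` differs from `s` only in arrays that `p` may change. -/
def Cmd.Frame (p : Cmd) (s s' : State) : Prop :=
  (∀ a, a ∉ p.natWrites → s'.nat a = s.nat a) ∧ ∀ a, a ∉ p.realWrites → s'.real a = s.real a

theorem Cmd.Frame.refl (p : Cmd) (s : State) : p.Frame s s := ⟨fun _ _ => rfl, fun _ _ => rfl⟩

theorem Cmd.Frame.trans {p : Cmd} {s s' s'' : State} (h : p.Frame s s') (h' : p.Frame s' s'') :
    p.Frame s s'' :=
  ⟨fun a ha => (h'.1 a ha).trans (h.1 a ha), fun a ha => (h'.2 a ha).trans (h.2 a ha)⟩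

theorem Cmd.Frame.mono {p q : Cmd} {s s' : State} (h : p.Frame s s')
    (hn : ∀ a, a ∈ p.natWrites → a ∈ q.natWrites)
    (hr : ∀ a, a ∈ p.realWrites → a ∈ q.realWrites) : q.Frame s s' :=
  ⟨fun a ha => h.1 a fun h' => ha (hn a h'), fun a ha => h.2 a fun h' => ha (hr a h')⟩

theorem Run.frame {p : Cmd} {s s' : State} {t : ℕ} (h : Run p s t s') : p.Frame s s' := by
  induction h with
  | skip s => exact Cmd.Frame.refl _ _
  | setNat s a i x =>
    refine ⟨fun b hb => ?_, fun b _ => rfl⟩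
    simp only [Cmd.natWrites, List.mem_singleton] at hb
    simp [State.setNat, hb]
  | setReal s a i x =>
    refine ⟨fun b _ => rfl, fun b hb => ?_⟩
    simp only [Cmd.realWrites, List.mem_singleton] at hb
    simp [State.setReal, hb]
  | seq _ _ h₁ h₂ =>
    exact (h₁.mono (by simp +contextual [Cmd.natWrites])
      (by simp +contextual [Cmd.realWrites])).trans
      (h₂.mono (by simp +contextual [Cmd.natWrites]) (by simp +contextual [Cmd.realWrites]))
  | ite_true _ _ h₁ =>
    exact h₁.mono (by simp +contextual [Cmd.natWrites]) (by simp +contextual [Cmd.realWrites])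
  | ite_false _ _ h₁ =>
    exact h₁.mono (by simp +contextual [Cmd.natWrites]) (by simp +contextual [Cmd.realWrites])
  | loop_true _ _ _ h₁ h₂ => exact Cmd.Frame.trans ⟨h₁.1, h₁.2⟩ h₂
  | loop_false _ => exact Cmd.Frame.refl _ _

/-- Started in `s`, the program `p` halts within `T` steps in a memory that satisfies `Q`. -/
def Cmd.Ensures (p : Cmd) (s : State) (T : ℕ) (Q : State → Prop) : Prop :=
  ∃ t s', Run p s t s' ∧ t ≤ T ∧ Q s'

theorem Cmd.Ensures.mono {p : Cmd} {s : State} {T T' : ℕ} {Q Q' : State → Prop}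
    (h : p.Ensures s T Q) (hT : T ≤ T') (hQ : ∀ s', p.Frame s s' → Q s' → Q' s') :
    p.Ensures s T' Q' :=
  let ⟨t, s', hr, ht, hq⟩ := h
  ⟨t, s', hr, ht.trans hT, hQ s' hr.frame hq⟩

theorem Cmd.Ensures.skip {s : State} {T : ℕ} {Q : State → Prop} (hT : 1 ≤ T) (h : Q s) :
    Cmd.skip.Ensures s T Q := ⟨1, s, Run.skip s, hT, h⟩

theorem Cmd.Ensures.setNat {a : ℕ} {i x : NExp} {s : State} {T : ℕ} {Q : State → Prop}
    (hT : i.cost + x.cost + 1 ≤ T) (h : Q (s.setNat a (i.eval s) (x.eval s))) :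
    (Cmd.setNat a i x).Ensures s T Q := ⟨_, _, Run.setNat s a i x, hT, h⟩

theorem Cmd.Ensures.setReal {a : ℕ} {i : NExp} {x : RExp} {s : State} {T : ℕ} {Q : State → Prop}
    (hT : i.cost + x.cost + 1 ≤ T) (h : Q (s.setReal a (i.eval s) (x.eval s))) :
    (Cmd.setReal a i x).Ensures s T Q := ⟨_, _, Run.setReal s a i x, hT, h⟩

theorem Cmd.Ensures.seq {p q : Cmd} {s : State} {T T' T'' : ℕ} {P Q : State → Prop}
    (hp : p.Ensures s T P) (hq : ∀ s', p.Frame s s' → P s' → q.Ensures s' T' Q)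
    (hT : T + T' ≤ T'') : (Cmd.seq p q).Ensures s T'' Q := by
  obtain ⟨t, s', hr, ht, h⟩ := hp
  obtain ⟨t', s'', hr', ht', h'⟩ := hq s' hr.frame h
  exact ⟨_, _, Run.seq hr hr', by omega, h'⟩

theorem Cmd.Ensures.ite {b : BExp} {p q : Cmd} {s : State} {T T' : ℕ} {Q : State → Prop}
    (hp : b.eval s → p.Ensures s T Q) (hq : ¬ b.eval s → q.Ensures s T Q)
    (hT : b.cost + T + 1 ≤ T') : (Cmd.ite b p q).Ensures s T' Q := by
  by_cases hb : b.eval s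
  · obtain ⟨t, s', hr, ht, h⟩ := hp hb
    exact ⟨_, _, Run.ite_true hb hr, by omega, h⟩
  · obtain ⟨t, s', hr, ht, h⟩ := hq hb
    exact ⟨_, _, Run.ite_false hb hr, by omega, h⟩

theorem Cmd.Ensures.loop {b : BExp} {p : Cmd} {s : State} {T N : ℕ} (Inv : ℕ → State → Prop)
    (h0 : Inv 0 s)
    (hstep : ∀ m < N, ∀ s', p.Frame s s' → Inv m s' → b.eval s' ∧ p.Ensures s' T (Inv (m + 1)))
    (hend : ∀ s', p.Frame s s' → Inv N s' → ¬ b.eval s') :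
    (Cmd.loop b p).Ensures s (N * (b.cost + T + 1) + (b.cost + 1)) (Inv N) := by
  have key : ∀ d m s', m + d = N → p.Frame s s' → Inv m s' →
      (Cmd.loop b p).Ensures s' (d * (b.cost + T + 1) + (b.cost + 1)) (Inv N) := by
    intro d
    induction d with
    | zero =>
      rintro m s' rfl hf hi
      exact ⟨_, _, Run.loop_false (hend s' hf hi), by omega, hi⟩
    | succ d ih =>
      intro m s' hm hf hi
      obtain ⟨hb, t, s'', hr, ht, hi'⟩ := hstep m (by omega) s' hf hi
      obtain ⟨t', s₃, hr', ht', hq⟩ := ih (m + 1) s'' (by omega) (hf.trans hr.frame) hi'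
      refine ⟨_, _, Run.loop_true hb hr hr', ?_, hq⟩
      rw [Nat.succ_mul]
      omega
  exact key N 0 s (by omega) (Cmd.Frame.refl _ _) h0

/-- Entry `0` of an array of natural numbers, used as a variable. -/
abbrev NExp.var (a : ℕ) : NExp := .read a (.const 0)

/-- Run `p` for the values `0, 1, …, N - 1` of the variable `a`. -/
def Cmd.forTo (a : ℕ) (N : NExp) (p : Cmd) : Cmd :=
  .seq (.setNat a (.const 0) (.const 0))
    (.loop (.not (.natLe N (.var a)))
      (.seq p (.setNat a (.const 0) (.add (.var a) (.const 1)))))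

theorem Cmd.natWrites_forTo (a : ℕ) (N : NExp) (p : Cmd) :
    (Cmd.forTo a N p).natWrites = a :: (p.natWrites ++ [a]) := rfl

theorem Cmd.realWrites_forTo (a : ℕ) (N : NExp) (p : Cmd) :
    (Cmd.forTo a N p).realWrites = p.realWrites ++ [] := rfl

theorem Cmd.Ensures.forTo {a : ℕ} {N : NExp} {p : Cmd} {s : State} {T T' n : ℕ}
    (Inv : ℕ → State → Prop) (ha : a ∉ p.natWrites)
    (hN : ∀ s', (Cmd.forTo a N p).Frame s s' → N.eval s' = n)
    (h0 : Inv 0 (s.setNat a 0 0))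
    (hstep : ∀ m < n, ∀ s', (Cmd.forTo a N p).Frame s s' → s'.nat a 0 = m → Inv m s' →
      p.Ensures s' T fun s'' => Inv (m + 1) (s''.setNat a 0 (m + 1)))
    (hT : n * (T + N.cost + 11) + (N.cost + 11) ≤ T') :
    (Cmd.forTo a N p).Ensures s T' (Inv n) := by
  have hF : (Cmd.forTo a N p).Frame s (s.setNat a 0 0) := by
    refine ⟨fun b hb => ?_, fun _ _ => rfl⟩
    have : b ≠ a := by
      rintro rfl
      simp [Cmd.natWrites_forTo] at hb
    simp [State.setNat, this]
  have hM : ∀ {s' s'' : State}, Cmd.Frame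
      (.seq p (.setNat a (.const 0) (.add (.var a) (.const 1)))) s' s'' →
      (Cmd.forTo a N p).Frame s' s'' := fun h => h.mono
    (fun b hb => by
      rw [Cmd.natWrites_forTo]
      exact List.mem_cons_of_mem _ hb)
    (fun b hb => by
      rw [Cmd.realWrites_forTo]
      exact hb)
  refine Cmd.Ensures.seq (T := 3) (T' := n * (T + N.cost + 11) + (N.cost + 5))
    (P := fun s' => s' = s.setNat a 0 0)
    (Cmd.Ensures.setNat le_rfl rfl) ?_ (by omega)
  rintro s' - rfl
  refine (Cmd.Ensures.loop (N := n) (T := T + 6)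
    (fun m s' => s'.nat a 0 = m ∧ Inv m s') ⟨by simp [State.setNat], h0⟩ ?_ ?_).mono ?_
    (fun s' _ h => h.2)
  · rintro m hm s' hf ⟨ham, hi⟩
    have hf' := hF.trans (hM hf)
    refine ⟨?_, ?_⟩
    · simp only [BExp.eval, NExp.eval, hN s' hf', ham]
      omega
    · refine Cmd.Ensures.seq (hstep m hm s' hf' ham hi) (T' := 6) ?_ le_rfl
      intro s'' hf'' hi''
      have h1 : s''.nat a 0 = m := by rw [hf''.1 a ha, ham]
      refine Cmd.Ensures.setNat (by simp [NExp.cost]) ?_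
      simp only [NExp.eval, h1]
      exact ⟨by simp [State.setNat], hi''⟩
  · rintro s' hf ⟨ham, -⟩
    simp only [BExp.eval, NExp.eval, hN s' (hF.trans (hM hf)), ham]
    omega
  · simp only [BExp.cost, NExp.cost]
    have : n * (N.cost + (1 + 1) + 1 + 1 + (T + 6) + 1) = n * (T + N.cost + 11) := by ring
    omega

end RealRAM

namespace Stabbing

open RealRAM

/-- The smallest key `> cur` among those of the first `m` items that satisfy `P`, or `cur` if there
is none. -/
noncomputable def nextKey (P : ℕ → Prop) (key : ℕ → ℝ) (cur : ℝ) : ℕ → ℝ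
  | 0 => cur
  | m + 1 => open Classical in
    if P m ∧ cur < key m ∧ (nextKey P key cur m ≤ cur ∨ key m < nextKey P key cur m) then key m
    else nextKey P key cur m

theorem nextKey_spec (P : ℕ → Prop) (key : ℕ → ℝ) (cur : ℝ) (m : ℕ) :
    (nextKey P key cur m = cur ∧ ∀ j < m, P j → key j ≤ cur) ∨
      (cur < nextKey P key cur m ∧ (∃ j < m, P j ∧ key j = nextKey P key cur m) ∧
        ∀ j < m, P j → cur < key j → nextKey P key cur m ≤ key j) := by
  induction m with
  | zero => simp [nextKey]
  | succ m ih =>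
    rw [nextKey]
    split_ifs with h
    · right
      refine ⟨h.2.1, ⟨m, by omega, h.1, rfl⟩, fun j hj hP hc => ?_⟩
      rcases Nat.lt_succ_iff_lt_or_eq.1 hj with hj | rfl
      · rcases ih with ⟨-, ih⟩ | ⟨ih₁, -, ih⟩
        · exact absurd hc (not_lt.2 (ih j hj hP))
        · rcases h.2.2 with h' | h'
          · exact absurd ih₁ (not_lt.2 h')
          · exact h'.le.trans (ih j hj hP hc)
      · exact le_rfl
    · rcases ih with ⟨ih₁, ih⟩ | ⟨ih₁, ⟨j₀, hj₀, hP₀, hk₀⟩, ih⟩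
      · left
        refine ⟨ih₁, fun j hj hP => ?_⟩
        rcases Nat.lt_succ_iff_lt_or_eq.1 hj with hj | rfl
        · exact ih j hj hP
        · by_contra hc
          exact h ⟨hP, not_le.1 hc, Or.inl ih₁.le⟩
      · right
        refine ⟨ih₁, ⟨j₀, by omega, hP₀, hk₀⟩, fun j hj hP hc => ?_⟩
        rcases Nat.lt_succ_iff_lt_or_eq.1 hj with hj | rfl
        · exact ih j hj hP hc
        · by_contra h'
          exact h ⟨hP, hc, Or.inr (not_le.1 h')⟩

/-- Among the first `n` items, those in `S`: every key `≥ cur` of an item of `S` is reached from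
`cur` in a number of steps that is bounded by the number of items of `S` with keys in between. -/
theorem exists_iterate_nextKey (S : Finset ℕ) {n : ℕ} (hS : ∀ j ∈ S, j < n) (key : ℕ → ℝ)
    {p : ℕ} (hp : p ∈ S) (cur : ℝ) (hc : cur ≤ key p) :
    ∃ q ≤ (S.filter fun j => cur < key j ∧ key j < key p).card + 1,
      (fun u => nextKey (· ∈ S) key u n)^[q] cur = key p := by
  induction hN : (S.filter fun j => cur < key j ∧ key j < key p).card using Nat.strong_induction_on
    generalizing cur with
  | _ N ih =>
  rcases hc.eq_or_lt with rfl | hc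
  · exact ⟨0, by omega, rfl⟩
  rcases nextKey_spec (· ∈ S) key cur n with ⟨-, h⟩ | ⟨h₁, ⟨j, hj, hjS, hjk⟩, h⟩
  · exact absurd hc (not_lt.2 (h p (hS p hp) hp))
  have hle := h p (hS p hp) hp hc
  rcases hle.eq_or_lt with he | hlt
  · exact ⟨1, by omega, he⟩
  have hlt' : (S.filter fun i => nextKey (· ∈ S) key cur n < key i ∧ key i < key p).card <
      (S.filter fun i => cur < key i ∧ key i < key p).card := by
    apply Finset.card_lt_card
    rw [Finset.ssubset_iff_of_subset]
    · refine ⟨j, ?_, ?_⟩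
      · simp only [Finset.mem_filter]
        exact ⟨hjS, hjk ▸ h₁, hjk ▸ hlt⟩
      · simp [hjk]
    · intro i
      simp only [Finset.mem_filter]
      exact fun hi => ⟨hi.1, h₁.trans hi.2.1, hi.2.2⟩
  obtain ⟨q, hq, hq'⟩ := ih _ (hN ▸ hlt') _ hle rfl
  refine ⟨q + 1, by omega, ?_⟩
  rw [Function.iterate_succ_apply]
  exact hq'

/-- Items `j` which appear in each direction `i` as an interval `[key i j, key i j + w i]`. -/
structure Intervals where
  key : ℕ → ℕ → ℝ
  w : ℕ → ℝ

namespace Intervals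

variable (I : Intervals)

/-- The line `(i, u)` hits the items whose intervals in direction `i` have their left endpoints
in `[u, u + w i]`. -/
def Hits (l : ℕ × ℝ) (j : ℕ) : Prop := l.2 ≤ I.key l.1 j ∧ I.key l.1 j ≤ l.2 + I.w l.1

/-- At most `κ` lines in the first `r` directions hit all items of `S`. -/
def Coverable (r : ℕ) (S : Finset ℕ) (κ : ℕ) : Prop :=
  ∃ L : Finset (ℕ × ℝ), L.card ≤ κ ∧ (∀ l ∈ L, l.1 < r) ∧ ∀ j ∈ S, ∃ l ∈ L, I.Hits l j

open Classical in
/-- Two lines in different directions hit at most `c` common items of `S`. -/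
def Shallow (r c : ℕ) (S : Finset ℕ) : Prop :=
  ∀ l l' : ℕ × ℝ, l.1 < r → l'.1 < r → l.1 ≠ l'.1 →
    (S.filter fun j => I.Hits l j ∧ I.Hits l' j).card ≤ c

/-- The candidate line in direction `i` with parameters `a` and `q`, when the items of `S` are
still to be hit. -/
noncomputable def candidate (n : ℕ) (S : Finset ℕ) (i a q : ℕ) : ℕ × ℝ :=
  (i, (fun u => nextKey (· ∈ S) (I.key i) u n)^[q] (I.key i (S.sup id) - (a + 1 : ℕ) * I.w i))

open Classical in
/-- The items of `S` that the candidate line does not hit. -/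
noncomputable def reduce (n : ℕ) (S : Finset ℕ) (i a q : ℕ) : Finset ℕ :=
  S.filter fun j => ¬ I.Hits (I.candidate n S i a q) j

/-- The items that remain after the candidate lines with parameters `dig` have been applied. -/
noncomputable def remaining (n : ℕ) (dig : ℕ → ℕ) : ℕ → Finset ℕ → Finset ℕ
  | 0, S => S
  | κ + 1, S => remaining n dig κ
      (I.reduce n S (dig (3 * κ)) (dig (3 * κ + 1)) (dig (3 * κ + 2)))

/-- The number of choices for each of the parameters. -/
def choices (r c : ℕ) (e : ℕ) : ℕ :=
  if e % 3 = 0 then r else if e % 3 = 1 then 4 * (e / 3 + 1) else 4 * (c * (e / 3 + 1))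

variable {I}

theorem Shallow.mono {r c : ℕ} {S S' : Finset ℕ} (h : I.Shallow r c S) (hS : S' ⊆ S) :
    I.Shallow r c S' := fun l l' hl hl' hne =>
  (Finset.card_le_card (by classical exact Finset.filter_subset_filter _ hS)).trans
    (h l l' hl hl' hne)

open Classical in
/-- Many items on a common line cannot all be hit by lines in other directions. -/
theorem exists_hits_of_card {r c κ : ℕ} {S F : Finset ℕ} (hsh : I.Shallow r c S) (hF : F ⊆ S)
    {L : Finset (ℕ × ℝ)} (hκ : L.card ≤ κ) (hr : ∀ l ∈ L, l.1 < r)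
    (hL : ∀ j ∈ S, ∃ l ∈ L, I.Hits l j) {l₀ : ℕ × ℝ} (hl₀ : l₀.1 < r)
    (hhit : ∀ j ∈ F, I.Hits l₀ j) (hcard : c * κ < F.card) :
    ∃ y ∈ F, ∃ l ∈ L, l.1 = l₀.1 ∧ I.Hits l y := by
  classical
  by_contra! hno
  have hsub : F ⊆ (L.filter fun l => l.1 ≠ l₀.1).biUnion
      fun l => S.filter fun j => I.Hits l j ∧ I.Hits l₀ j := by
    intro j hj
    obtain ⟨l, hl, hlj⟩ := hL j (hF hj)
    simp only [Finset.mem_biUnion, Finset.mem_filter]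
    exact ⟨l, ⟨hl, fun he => hno j hj l hl he hlj⟩, hF hj, hlj, hhit j hj⟩
  have h1 := (Finset.card_le_card hsub).trans (Finset.card_biUnion_le_card_mul _ _ c
    fun l hl => by
      rw [Finset.mem_filter] at hl
      convert hsh l l₀ (hr l hl.1) hl₀ hl.2)
  have h2 : (L.filter fun l => l.1 ≠ l₀.1).card ≤ κ := (Finset.card_filter_le _ _).trans hκ
  have : (L.filter fun l => l.1 ≠ l₀.1).card * c ≤ c * κ := by
    rw [mul_comm]
    gcongr
  omega

open Classical in
/-- A line may be moved to the smallest key among the items that it hits. -/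
theorem exists_hits_min {S : Finset ℕ} {L : Finset (ℕ × ℝ)} {r κ : ℕ} (hκ : L.card ≤ κ + 1)
    (hr : ∀ l ∈ L, l.1 < r) (hL : ∀ j ∈ S, ∃ l ∈ L, I.Hits l j) {l : ℕ × ℝ} (hl : l ∈ L) {y : ℕ}
    (hy : y ∈ S) (hly : I.Hits l y) :
    ∃ p ∈ S, l.2 ≤ I.key l.1 p ∧ I.key l.1 p ≤ I.key l.1 y ∧ ∀ S' ⊆ S,
      (∀ j ∈ S', ¬ I.Hits (l.1, I.key l.1 p) j) → I.Coverable r S' κ := by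
  classical
  obtain ⟨p, hp, hmin⟩ := Finset.exists_min_image (S.filter fun j => I.Hits l j) (I.key l.1)
    ⟨y, Finset.mem_filter.2 ⟨hy, hly⟩⟩
  rw [Finset.mem_filter] at hp
  refine ⟨p, hp.1, hp.2.1, hmin y (Finset.mem_filter.2 ⟨hy, hly⟩), fun S' hS' hS'p => ?_⟩
  refine ⟨L.erase l, ?_, fun l' hl' => hr l' (Finset.mem_of_mem_erase hl'), fun j hj => ?_⟩
  · rw [Finset.card_erase_of_mem hl]
    omega
  · obtain ⟨l', hl', hlj⟩ := hL j (hS' hj)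
    refine ⟨l', Finset.mem_erase.2 ⟨?_, hl'⟩, hlj⟩
    rintro rfl
    refine hS'p j hj ⟨hmin j (Finset.mem_filter.2 ⟨hS' hj, hlj⟩), ?_⟩
    have := hp.2.1
    have := hlj.2
    simp only at *
    linarith

theorem coverable_reduce_aux {n r κ : ℕ} {S : Finset ℕ} (hS : ∀ j ∈ S, j < n) {p i a B : ℕ}
    (hp : p ∈ S) (ha : I.key i (S.sup id) - (a + 1 : ℕ) * I.w i ≤ I.key i p)
    (hB : (S.filter fun j => I.key i (S.sup id) - (a + 1 : ℕ) * I.w i < I.key i j ∧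
      I.key i j < I.key i p).card + 1 < B)
    (hcov : ∀ S' ⊆ S, (∀ j ∈ S', ¬ I.Hits (i, I.key i p) j) → I.Coverable r S' κ) :
    ∃ q < B, I.Coverable r (I.reduce n S i a q) κ := by
  obtain ⟨q, hq, he⟩ := exists_iterate_nextKey S hS (I.key i) hp _ ha
  classical
  refine ⟨q, by omega, hcov _ (Finset.filter_subset _ _) fun j hj => ?_⟩
  have := (Finset.mem_filter.1 hj).2
  rwa [candidate, he] at this

open Classical in
/-- The items with keys between `a + 1` and `a` widths to the left of the largest item. -/
noncomputable def window (I : Intervals) (S : Finset ℕ) (i a : ℕ) : Finset ℕ :=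
  S.filter fun j => I.key i (S.sup id) - (a + 1 : ℕ) * I.w i ≤ I.key i j ∧
    I.key i j < I.key i (S.sup id) - a * I.w i

theorem hits_of_mem_window {S : Finset ℕ} {i a j : ℕ} (hj : j ∈ I.window S i a) :
    I.Hits (i, I.key i (S.sup id) - (a + 1 : ℕ) * I.w i) j := by
  simp only [window, Finset.mem_filter] at hj
  refine ⟨hj.2.1, ?_⟩
  have := hj.2.2
  simp only
  push_cast
  linarith

theorem exists_card_window_le {r c κ : ℕ} {S : Finset ℕ} (hsh : I.Shallow r c S)
    {L : Finset (ℕ × ℝ)} (hκ : L.card ≤ κ) (hr : ∀ l ∈ L, l.1 < r)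
    (hL : ∀ j ∈ S, ∃ l ∈ L, I.Hits l j) {i : ℕ} (hi : i < r) (hw : 0 ≤ I.w i) :
    ∃ a ≤ 2 * κ, (I.window S i a).card ≤ c * κ := by
  by_contra! hno
  have h : ∀ m : ℕ, ∃ l : ℕ × ℝ, m < κ + 1 →
      l ∈ L ∧ l.1 = i ∧ ∃ y ∈ I.window S i (2 * m), I.Hits l y := by
    intro m
    by_cases hm : m < κ + 1
    · obtain ⟨y, hy, l, hl, hli, hly⟩ := exists_hits_of_card hsh
        (Finset.filter_subset _ S) hκ hr hL (l₀ := (i, _)) hi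
        (fun j hj => hits_of_mem_window hj) (hno (2 * m) (by omega))
      exact ⟨l, fun _ => ⟨hl, hli, y, hy, hly⟩⟩
    · exact ⟨(0, 0), fun h => absurd h hm⟩
  choose f hf using h
  obtain ⟨m, hm, m', hm', hne, he⟩ := Finset.exists_ne_map_eq_of_card_lt_of_maps_to
    (s := Finset.range (κ + 1)) (t := L) (f := f) (by simp; omega)
    (fun m hm => (hf m (Finset.mem_range.1 hm)).1)
  wlog hlt : m < m' generalizing m m'
  · exact this m' hm' m hm hne.symm he.symm (by omega)
  obtain ⟨-, hi₁, y, hy, hly⟩ := hf m (Finset.mem_range.1 hm)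
  obtain ⟨-, -, z, hz, hlz⟩ := hf m' (Finset.mem_range.1 hm')
  rw [← he] at hlz
  simp only [window, Finset.mem_filter] at hy hz
  have h1 := hly.2
  have h2 := hlz.1
  rw [hi₁] at h1 h2
  have h3 := hy.2.1
  have h4 := hz.2.2
  have h5 : ((2 * m + 1 : ℕ) + 1 : ℝ) * I.w i ≤ (2 * m' : ℕ) * I.w i := by
    apply mul_le_mul_of_nonneg_right _ hw
    exact_mod_cast (by omega : 2 * m + 1 + 1 ≤ 2 * m')
  linarith

/-- If `κ + 1` lines hit all items of `S`, then some candidate line can be part of a solution. -/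
theorem Coverable.exists_reduce {n r c κ : ℕ} {S : Finset ℕ} (hS : ∀ j ∈ S, j < n)
    (hne : S.Nonempty) (hc : 1 ≤ c) (hw : ∀ i < r, 0 ≤ I.w i) (hsh : I.Shallow r c S)
    (h : I.Coverable r S (κ + 1)) :
    ∃ i < r, ∃ a < 4 * (κ + 1), ∃ q < 4 * (c * (κ + 1)), I.Coverable r (I.reduce n S i a q) κ := by
  classical
  obtain ⟨L, hκ, hr, hL⟩ := h
  have hcκ : 1 ≤ c * (κ + 1) := Nat.one_le_iff_ne_zero.2 (by positivity)
  have hx : S.sup id ∈ S := by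
    obtain ⟨x, hx, he⟩ := Finset.exists_mem_eq_sup S hne id
    rw [he]
    exact hx
  by_cases hlight : ∀ i < r, (I.window S i 0).card ≤ c * (κ + 1)
  · obtain ⟨⟨i, u⟩, hl, hlx⟩ := hL _ hx
    have hi := hr _ hl
    obtain ⟨p, hp, hup, hpx, hcov⟩ := exists_hits_min hκ hr hL hl hx hlx
    have h1 := hlx.2
    simp only at h1 hup hpx hi
    refine ⟨i, hi, 0, by omega, coverable_reduce_aux hS hp (by push_cast; linarith) ?_ hcov⟩
    · refine lt_of_le_of_lt (Nat.succ_le_succ ((Finset.card_le_card ?_).trans (hlight i hi))) ?_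
      · intro j
        simp only [window, Finset.mem_filter]
        refine fun hj => ⟨hj.1, hj.2.1.le, ?_⟩
        push_cast
        linarith [hj.2.2]
      · omega
  · push Not at hlight
    obtain ⟨i, hi, hheavy⟩ := hlight
    have hex := exists_card_window_le hsh hκ hr hL hi (hw i hi)
    set a := Nat.find hex with ha_def
    obtain ⟨ha, hcard⟩ := Nat.find_spec hex
    rw [← ha_def] at ha hcard
    obtain ⟨b, hb⟩ : ∃ b, a = b + 1 := Nat.exists_eq_succ_of_ne_zero fun h0 => by
      rw [h0] at hcard
      omega
    have hbcard : c * (κ + 1) < (I.window S i b).card := by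
      have := Nat.find_min hex (m := b) (by omega)
      push Not at this
      exact this (by omega)
    obtain ⟨y₀, hy₀, l₀, hl₀, hli₀, hly₀⟩ := exists_hits_of_card hsh
      (Finset.filter_subset _ S) hκ hr hL (l₀ := (i, _)) hi
      (fun j hj => hits_of_mem_window hj) hbcard
    obtain ⟨y, hy, hymin⟩ := Finset.exists_min_image
      ((I.window S i b).filter fun y => ∃ l ∈ L, l.1 = i ∧ I.Hits l y) (I.key i)
      ⟨y₀, Finset.mem_filter.2 ⟨hy₀, l₀, hl₀, hli₀, hly₀⟩⟩
    obtain ⟨hyw, ⟨i', u⟩, hl, hli, hly⟩ := Finset.mem_filter.1 hy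
    obtain rfl : i' = i := hli
    have hfew : ((I.window S i' b).filter fun j => I.key i' j < I.key i' y).card ≤
        c * (κ + 1) := by
      by_contra hlt
      obtain ⟨z, hz, l', hl', hli', hlz'⟩ := exists_hits_of_card hsh
        ((Finset.filter_subset _ _).trans (Finset.filter_subset _ S)) hκ hr hL (l₀ := (i', _)) hi
        (fun j hj => hits_of_mem_window (Finset.filter_subset _ _ hj)) (not_le.1 hlt)
      rw [Finset.mem_filter] at hz
      exact absurd hz.2
        (not_lt.2 (hymin z (Finset.mem_filter.2 ⟨hz.1, l', hl', hli', hlz'⟩)))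
    have hyS := Finset.filter_subset _ _ hyw
    obtain ⟨p, hp, hup, hpy, hcov⟩ := exists_hits_min hκ hr hL hl hyS hly
    have h1 := hly.2
    have h2 := (Finset.mem_filter.1 hyw).2.1
    simp only at h1 hup hpy
    refine ⟨i', hi, a, by omega, coverable_reduce_aux hS hp
      (by rw [hb]; push_cast at h2 ⊢; linarith) ?_ hcov⟩
    · have hsub : (S.filter fun j =>
          I.key i' (S.sup id) - (a + 1 : ℕ) * I.w i' < I.key i' j ∧ I.key i' j < I.key i' p) ⊆
          I.window S i' a ∪ (I.window S i' b).filter fun j => I.key i' j < I.key i' y := by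
        intro j
        simp only [Finset.mem_union, window, Finset.mem_filter]
        rintro ⟨hj, hj₁, hj₂⟩
        have hj₃ := hj₂.trans_le hpy
        by_cases hja : I.key i' j < I.key i' (S.sup id) - a * I.w i'
        · exact Or.inl ⟨hj, hj₁.le, hja⟩
        · refine Or.inr ⟨⟨hj, ?_, ?_⟩, hj₃⟩
          · rw [hb] at hja
            exact not_lt.1 hja
          · exact hj₃.trans (Finset.mem_filter.1 hyw).2.2
      have := (Finset.card_le_card hsub).trans (Finset.card_union_le _ _)
      omega

theorem choices_zero (r c κ : ℕ) : choices r c (3 * κ) = r := by simp [choices]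

theorem choices_one (r c κ : ℕ) : choices r c (3 * κ + 1) = 4 * (κ + 1) := by
  have h1 : (3 * κ + 1) % 3 = 1 := by omega
  have h2 : (3 * κ + 1) / 3 = κ := by omega
  simp [choices, h1, h2]

theorem choices_two (r c κ : ℕ) : choices r c (3 * κ + 2) = 4 * (c * (κ + 1)) := by
  have h1 : (3 * κ + 2) % 3 = 2 := by omega
  have h2 : (3 * κ + 2) / 3 = κ := by omega
  simp [choices, h1, h2]

theorem choices_pos {r c : ℕ} (hr : 1 ≤ r) (hc : 1 ≤ c) (e : ℕ) : 0 < choices r c e := by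
  rw [choices]
  split_ifs
  · exact hr
  · positivity
  · positivity

theorem prod_choices (r c k : ℕ) :
    ∏ e ∈ Finset.range (3 * k), choices r c e = (16 * (r * c)) ^ k * k.factorial ^ 2 := by
  induction k with
  | zero => rfl
  | succ k ih =>
    rw [show 3 * (k + 1) = 3 * k + 1 + 1 + 1 by ring, Finset.prod_range_succ,
      Finset.prod_range_succ, Finset.prod_range_succ, ih, choices_zero, choices_one, choices_two,
      Nat.factorial_succ]
    ring

theorem reduce_subset {n : ℕ} {S : Finset ℕ} {i a q : ℕ} : I.reduce n S i a q ⊆ S :=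
  by classical exact Finset.filter_subset _ _

theorem remaining_congr {n κ : ℕ} {dig dig' : ℕ → ℕ} (h : ∀ e < 3 * κ, dig e = dig' e)
    (S : Finset ℕ) : I.remaining n dig κ S = I.remaining n dig' κ S := by
  induction κ generalizing S with
  | zero => rfl
  | succ κ ih =>
    rw [remaining, remaining, h _ (by omega), h _ (by omega), h _ (by omega),
      ih fun e he => h e (by omega)]

theorem coverable_of_remaining {n r κ : ℕ} {dig : ℕ → ℕ} (hd : ∀ e < κ, dig (3 * e) < r)
    {S : Finset ℕ} (h : I.remaining n dig κ S = ∅) : I.Coverable r S κ := by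
  classical
  induction κ generalizing S with
  | zero =>
    rw [remaining] at h
    exact ⟨∅, by simp [h]⟩
  | succ κ ih =>
    obtain ⟨L, hκ, hr, hL⟩ := ih (fun e he => hd e (by omega)) h
    refine ⟨insert (I.candidate n S (dig (3 * κ)) (dig (3 * κ + 1)) (dig (3 * κ + 2))) L,
      (Finset.card_insert_le _ _).trans (by omega), ?_, fun j hj => ?_⟩
    · intro l hl
      rcases Finset.mem_insert.1 hl with rfl | hl
      · exact hd κ (by omega)
      · exact hr l hl
    · by_cases hh : I.Hits (I.candidate n S (dig (3 * κ)) (dig (3 * κ + 1)) (dig (3 * κ + 2))) j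
      · exact ⟨_, Finset.mem_insert_self _ _, hh⟩
      · obtain ⟨l, hl, hlj⟩ := hL j (Finset.mem_filter.2 ⟨hj, hh⟩)
        exact ⟨l, Finset.mem_insert_of_mem hl, hlj⟩

theorem Coverable.exists_remaining {n r c κ : ℕ} {S : Finset ℕ} (hS : ∀ j ∈ S, j < n)
    (hr : 1 ≤ r) (hc : 1 ≤ c) (hw : ∀ i < r, 0 ≤ I.w i) (hsh : I.Shallow r c S)
    (h : I.Coverable r S κ) :
    ∃ dig : ℕ → ℕ, (∀ e < 3 * κ, dig e < choices r c e) ∧ I.remaining n dig κ S = ∅ := by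
  induction κ generalizing S with
  | zero =>
    obtain ⟨L, hL, -, hS'⟩ := h
    obtain rfl : L = ∅ := by simpa using hL
    refine ⟨fun _ => 0, by simp, Finset.eq_empty_of_forall_notMem fun j hj => ?_⟩
    simpa using hS' j hj
  | succ κ ih =>
    obtain ⟨i, hi, a, ha, q, hq, hcov⟩ : ∃ i < r, ∃ a < 4 * (κ + 1), ∃ q < 4 * (c * (κ + 1)),
        I.Coverable r (I.reduce n S i a q) κ := by
      rcases S.eq_empty_or_nonempty with rfl | hne
      · exact ⟨0, hr, 0, by omega, 0, by positivity, ∅, by simp, by simp, by simp [reduce]⟩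
      · exact h.exists_reduce hS hne hc hw hsh
    obtain ⟨dig, hd, hrem⟩ :=
      ih (fun j hj => hS j (reduce_subset hj)) (hsh.mono reduce_subset) hcov
    refine ⟨fun e => if e = 3 * κ then i else if e = 3 * κ + 1 then a else
      if e = 3 * κ + 2 then q else dig e, fun e he => ?_, ?_⟩
    · beta_reduce
      split_ifs with h0 h1 h2
      · rw [h0, choices_zero]; exact hi
      · rw [h1, choices_one]; exact ha
      · rw [h2, choices_two]; exact hq
      · exact hd e (by omega)
    · rw [remaining]
      simp only [if_true, Nat.add_eq_left, one_ne_zero, if_false, OfNat.ofNat_ne_zero,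
        Nat.add_left_cancel_iff, OfNat.ofNat_ne_one]
      rw [remaining_congr (dig' := dig) (fun e he => ?_)]
      · exact hrem
      · rw [if_neg (by omega), if_neg (by omega), if_neg (by omega)]

theorem coverable_iff_exists_remaining {n r c κ : ℕ} {S : Finset ℕ} (hS : ∀ j ∈ S, j < n)
    (hr : 1 ≤ r) (hc : 1 ≤ c) (hw : ∀ i < r, 0 ≤ I.w i) (hsh : I.Shallow r c S) :
    I.Coverable r S κ ↔
      ∃ dig : ℕ → ℕ, (∀ e < 3 * κ, dig e < choices r c e) ∧ I.remaining n dig κ S = ∅ :=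
  ⟨Coverable.exists_remaining hS hr hc hw hsh, fun ⟨dig, hd, h⟩ =>
    coverable_of_remaining (fun e he => by
      have := hd (3 * e) (by omega)
      rwa [choices_zero] at this) h⟩

end Intervals

/-- The `e`-th digit of `t` in the mixed radix system with radices `b`. -/
def digit (b : ℕ → ℕ) (t e : ℕ) : ℕ := t / (∏ i ∈ Finset.range e, b i) % b e

theorem digit_zero (b : ℕ → ℕ) (e : ℕ) : digit b 0 e = 0 := by simp [digit]

theorem digit_lt {b : ℕ → ℕ} {e : ℕ} (hb : 0 < b e) (t : ℕ) : digit b t e < b e :=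
  Nat.mod_lt _ hb

theorem digit_succ_of_not_dvd {b : ℕ → ℕ} {t e : ℕ} (h : ¬ (∏ i ∈ Finset.range e, b i) ∣ t + 1) :
    digit b (t + 1) e = digit b t e := by
  rw [digit, digit, Nat.succ_div, if_neg h, add_zero]

theorem prod_dvd_succ_iff {b : ℕ → ℕ} {t e : ℕ} (hb : ∀ i ≤ e, 0 < b i)
    (h : (∏ i ∈ Finset.range e, b i) ∣ t + 1) :
    (∏ i ∈ Finset.range (e + 1), b i) ∣ t + 1 ↔ b e ≤ digit b t e + 1 := by
  have hP : 0 < ∏ i ∈ Finset.range e, b i :=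
    Finset.prod_pos fun i hi => hb i (Finset.mem_range.1 hi).le
  have h1 : (t + 1) / (∏ i ∈ Finset.range e, b i) = t / (∏ i ∈ Finset.range e, b i) + 1 := by
    rw [Nat.succ_div, if_pos h]
  rw [Finset.prod_range_succ, ← Nat.dvd_div_iff_mul_dvd h, h1, digit]
  generalize t / (∏ i ∈ Finset.range e, b i) = u
  have hbe := hb e le_rfl
  have hu := Nat.mod_lt u hbe
  have hdvd : b e ∣ u + 1 ↔ b e ∣ u % b e + 1 := by
    conv_lhs => rw [← Nat.mod_add_div u (b e), add_right_comm]
    exact Nat.dvd_add_left (dvd_mul_right _ _)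
  rw [hdvd]
  exact ⟨fun h => Nat.le_of_dvd (by omega) h, fun h => by
    rw [show u % b e + 1 = b e by omega]⟩

theorem digit_succ_of_dvd {b : ℕ → ℕ} {t e : ℕ} (hb : ∀ i ≤ e, 0 < b i)
    (h : (∏ i ∈ Finset.range e, b i) ∣ t + 1) :
    digit b (t + 1) e = if b e ≤ digit b t e + 1 then 0 else digit b t e + 1 := by
  have hbe := hb e le_rfl
  have := digit_lt hbe t
  have h1 : (t + 1) / (∏ i ∈ Finset.range e, b i) = t / (∏ i ∈ Finset.range e, b i) + 1 := by
    rw [Nat.succ_div, if_pos h]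
  rw [digit, h1, Nat.add_mod, ← digit]
  split_ifs with hle
  · rw [Nat.add_mod_mod, show digit b t e + 1 = b e by omega, Nat.mod_self]
  · rw [Nat.add_mod_mod, Nat.mod_eq_of_lt (by omega)]

theorem exists_digit_eq {b : ℕ → ℕ} (E : ℕ) (dig : ℕ → ℕ) (h : ∀ e < E, dig e < b e) :
    ∃ t < ∏ i ∈ Finset.range E, b i, ∀ e < E, digit b t e = dig e := by
  induction E with
  | zero => exact ⟨0, by simp⟩
  | succ E ih =>
    obtain ⟨t, ht, hd⟩ := ih fun e he => h e (by omega)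
    have hE := h E (by omega)
    have hP : 0 < ∏ i ∈ Finset.range E, b i := by omega
    refine ⟨t + (∏ i ∈ Finset.range E, b i) * dig E, ?_, fun e he => ?_⟩
    · rw [Finset.prod_range_succ]
      calc _ < (∏ i ∈ Finset.range E, b i) * 1 + (∏ i ∈ Finset.range E, b i) * dig E := by omega
        _ = (∏ i ∈ Finset.range E, b i) * (dig E + 1) := by ring
        _ ≤ _ := Nat.mul_le_mul_left _ hE
    · rcases Nat.lt_succ_iff_lt_or_eq.1 he with he | rfl
      · rw [← hd e he, digit, digit]
        have hPe : 0 < ∏ i ∈ Finset.range e, b i :=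
          Finset.prod_pos fun i hi => by
            have := h i (by have := Finset.mem_range.1 hi; omega)
            omega
        obtain ⟨m, hm⟩ : (∏ i ∈ Finset.range (e + 1), b i) ∣ ∏ i ∈ Finset.range E, b i :=
          Finset.prod_dvd_prod_of_subset _ _ _ (Finset.range_subset_range.2 he)
        rw [hm, Finset.prod_range_succ, mul_assoc, mul_assoc, Nat.add_mul_div_left _ _ hPe,
          Nat.add_mul_mod_self_left]
      · rw [digit, Nat.add_mul_div_left _ _ hP, Nat.div_eq_of_lt ht, zero_add,
          Nat.mod_eq_of_lt hE]

/-! The memory layout of the programs. Natural numbers: `0` to `3` the input `n`, `k`, `c`, `r`;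
`4` the marks of the items; `5` the digits and `6` their numbers of choices; `8` the picked item;
`9` the address of the keys of the current direction; `11` the address of the current digits;
`14` the answer; `16` the carry; `17` the number of digits; `7`, `10`, `12`, `15` and `18` counters.
Real numbers: `6` the keys, `7` the widths, `8` and `9` the current and the next key. -/

/-- The unmarked items. -/
def unmarked (n : ℕ) (s : State) : Finset ℕ := (Finset.range n).filter fun j => s.nat 4 j = 0

theorem unmarked_congr {n : ℕ} {s s' : State} (h : s'.nat 4 = s.nat 4) :
    unmarked n s' = unmarked n s := by simp [unmarked, h]

theorem mem_unmarked {n : ℕ} {s : State} {j : ℕ} : j ∈ unmarked n s ↔ j < n ∧ s.nat 4 j = 0 := by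
  simp [unmarked]

/-- The memory contains a description of the intervals in `r` directions of `n` items. -/
structure Loaded (I : Intervals) (n k c r : ℕ) (s : State) : Prop where
  n_eq : s.nat 0 0 = n
  k_eq : s.nat 1 0 = k
  c_eq : s.nat 2 0 = c
  r_eq : s.nat 3 0 = r
  key_eq : ∀ i < r, ∀ j < n, s.real 6 (i * n + j) = I.key i j
  w_eq : ∀ i < r, s.real 7 i = I.w i

/-- The arrays that hold the description of the intervals are not changed by `p`. -/
def KeepsInput (p : Cmd) : Prop :=
  (0 ∉ p.natWrites ∧ 1 ∉ p.natWrites ∧ 2 ∉ p.natWrites ∧ 3 ∉ p.natWrites) ∧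
    6 ∉ p.realWrites ∧ 7 ∉ p.realWrites

instance (p : Cmd) : Decidable (KeepsInput p) := by unfold KeepsInput; infer_instance

theorem Loaded.of_frame {I : Intervals} {n k c r : ℕ} {s s' : State} {p : Cmd}
    (h : Loaded I n k c r s) (hf : p.Frame s s') (hp : KeepsInput p) : Loaded I n k c r s' where
  n_eq := by rw [hf.1 0 hp.1.1, h.n_eq]
  k_eq := by rw [hf.1 1 hp.1.2.1, h.k_eq]
  c_eq := by rw [hf.1 2 hp.1.2.2.1, h.c_eq]
  r_eq := by rw [hf.1 3 hp.1.2.2.2, h.r_eq]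
  key_eq := by rw [hf.2 6 hp.2.1]; exact h.key_eq
  w_eq := by rw [hf.2 7 hp.2.2]; exact h.w_eq

/-- Find the last unmarked item. -/
def pickItem : Cmd :=
  .seq (.setNat 8 (.const 0) (.const 0))
    (.forTo 7 (.var 0)
      (.ite (.natLe (.read 4 (.var 7)) (.const 0)) (.setNat 8 (.const 0) (.var 7)) .skip))

theorem pickItem_ensures {s : State} {n : ℕ} (hn : s.nat 0 0 = n) :
    pickItem.Ensures s (40 * (n + 1)) fun s' => s'.nat 8 0 = (unmarked n s).sup id := by
  refine Cmd.Ensures.seq (P := fun s' => s' = s.setNat 8 0 0)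
    (T' := 30 * (n + 1)) (Cmd.Ensures.setNat le_rfl rfl) ?_
    (by simp only [NExp.cost]; omega)
  rintro s₁ hf₁ rfl
  refine Cmd.Ensures.forTo (n := n) (T := 10)
    (fun m s' => s'.nat 8 0 = (unmarked m s).sup id) (by decide) ?_ ?_ ?_
    (by simp only [NExp.cost]; omega)
  · intro s' hf
    simp only [NExp.eval]
    rw [hf.1 0 (by decide), hf₁.1 0 (by decide), hn]
  · simp [State.setNat, unmarked]
  · intro m hm s' hf hc hi
    have h4 : s'.nat 4 = s.nat 4 := by rw [hf.1 4 (by decide), hf₁.1 4 (by decide)]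
    have hs : unmarked (m + 1) s = if s.nat 4 m = 0 then insert m (unmarked m s)
        else unmarked m s := by
      simp only [unmarked, Finset.range_add_one, Finset.filter_insert]
    refine Cmd.Ensures.ite (T := 4) (fun hb => ?_) (fun hb => ?_) (by simp [BExp.cost, NExp.cost])
    · refine Cmd.Ensures.setNat (by simp [NExp.cost]) ?_
      simp only [BExp.eval, NExp.eval, hc, h4, Nat.le_zero] at hb
      rw [hs, if_pos hb, Finset.sup_insert]
      simp only [State.setNat, NExp.eval, hc]
      have : (unmarked m s).sup id ≤ m := Finset.sup_le fun j hj => (mem_unmarked.1 hj).1.le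
      simp [this]
    · refine Cmd.Ensures.skip (by norm_num) ?_
      simp only [BExp.eval, NExp.eval, hc, h4, Nat.le_zero] at hb
      rw [hs, if_neg hb]
      simpa [State.setNat] using hi

/-- Compute the address of the keys for the current direction. -/
def computeBase : Cmd :=
  .seq (.setNat 9 (.const 0) (.const 0))
    (.forTo 12 (.read 5 (.var 11)) (.setNat 9 (.const 0) (.add (.var 9) (.var 0))))

theorem computeBase_ensures {s : State} {n i : ℕ} (hn : s.nat 0 0 = n)
    (hi : s.nat 5 (s.nat 11 0) = i) :
    computeBase.Ensures s (40 * (i + 1)) fun s' => s'.nat 9 0 = i * n := by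
  refine Cmd.Ensures.seq (P := fun s' => s' = s.setNat 9 0 0)
    (T' := 30 * (i + 1)) (Cmd.Ensures.setNat le_rfl rfl) ?_
    (by simp only [NExp.cost]; omega)
  rintro s₁ hf₁ rfl
  refine Cmd.Ensures.forTo (n := i) (T := 10)
    (fun m s' => s'.nat 9 0 = m * n) (by decide) ?_ ?_ ?_
    (by simp only [NExp.cost]; omega)
  · intro s' hf
    simp only [NExp.eval]
    rw [hf.1 5 (by decide), hf₁.1 5 (by decide), hf.1 11 (by decide), hf₁.1 11 (by decide), hi]
  · simp [State.setNat]
  · intro m hm s' hf hc hinv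
    have h0 : s'.nat 0 = s.nat 0 := by rw [hf.1 0 (by decide), hf₁.1 0 (by decide)]
    refine Cmd.Ensures.setNat (by simp [NExp.cost]) ?_
    simp [State.setNat, NExp.eval, hinv, h0, hn, Nat.succ_mul]

/-- The left end of the range of candidate keys. -/
def startKey : Cmd :=
  .seq (.setReal 8 (.const 0)
      (.sub (.read 6 (.add (.var 9) (.var 8))) (.read 7 (.read 5 (.var 11)))))
    (.forTo 12 (.read 5 (.add (.var 11) (.const 1)))
      (.setReal 8 (.const 0) (.sub (.read 8 (.const 0)) (.read 7 (.read 5 (.var 11))))))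

theorem startKey_ensures {s : State} {a : ℕ} (ha : s.nat 5 (s.nat 11 0 + 1) = a) :
    startKey.Ensures s (40 * (a + 1)) fun s' => s'.real 8 0 =
      s.real 6 (s.nat 9 0 + s.nat 8 0) - (a + 1 : ℕ) * s.real 7 (s.nat 5 (s.nat 11 0)) := by
  refine Cmd.Ensures.seq
    (P := fun s' => s'.real 8 0 =
      s.real 6 (s.nat 9 0 + s.nat 8 0) - s.real 7 (s.nat 5 (s.nat 11 0)))
    (T := 13) (T' := 27 * (a + 1))
    (Cmd.Ensures.setReal (by simp [NExp.cost, RExp.cost]) ?_) ?_ (by omega)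
  · simp [State.setReal, RExp.eval, NExp.eval]
  intro s₁ hf₁ h₁
  refine Cmd.Ensures.forTo (n := a) (T := 10)
    (fun m s' => s'.real 8 0 =
      s.real 6 (s.nat 9 0 + s.nat 8 0) - (m + 1 : ℕ) * s.real 7 (s.nat 5 (s.nat 11 0)))
    (by decide) ?_ ?_ ?_ (by simp only [NExp.cost]; omega)
  · intro s' hf
    simp only [NExp.eval]
    rw [hf.1 5 (by decide), hf₁.1 5 (by decide), hf.1 11 (by decide), hf₁.1 11 (by decide), ha]
  · simp [State.setNat, h₁]
  · intro m hm s' hf hc hinv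
    have h5 : s'.nat 5 = s.nat 5 := by rw [hf.1 5 (by decide), hf₁.1 5 (by decide)]
    have h11 : s'.nat 11 = s.nat 11 := by rw [hf.1 11 (by decide), hf₁.1 11 (by decide)]
    have h7 : s'.real 7 = s.real 7 := by rw [hf.2 7 (by decide), hf₁.2 7 (by decide)]
    refine Cmd.Ensures.setReal (by simp [NExp.cost, RExp.cost]) ?_
    simp only [State.setNat, State.setReal, RExp.eval, NExp.eval, hinv, h5, h11, h7,
      Function.update_self]
    push_cast
    ring

/-- The key of the current item in the current direction. -/
def currentKey : RExp := .read 6 (.add (.var 9) (.var 7))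

/-- Proceed to the next key of an unmarked item in the current direction. -/
def stepKey : Cmd :=
  .seq (.setReal 9 (.const 0) (.read 8 (.const 0)))
    (.seq (.forTo 7 (.var 0)
        (.ite (.and (.natLe (.read 4 (.var 7)) (.const 0))
            (.and (.not (.realLe currentKey (.read 8 (.const 0))))
              (.not (.and (.not (.realLe (.read 9 (.const 0)) (.read 8 (.const 0))))
                (.realLe (.read 9 (.const 0)) currentKey)))))
          (.setReal 9 (.const 0) currentKey) .skip))
      (.setReal 8 (.const 0) (.read 9 (.const 0))))

theorem stepKey_ensures {s : State} {n : ℕ} {key : ℕ → ℝ} (hn : s.nat 0 0 = n)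
    (hkey : ∀ j < n, s.real 6 (s.nat 9 0 + j) = key j) :
    stepKey.Ensures s (80 * (n + 1)) fun s' =>
      s'.real 8 0 = nextKey (· ∈ unmarked n s) key (s.real 8 0) n := by
  refine Cmd.Ensures.seq (P := fun s' => s'.real 9 0 = s.real 8 0) (T := 10)
    (T' := 60 * (n + 1) + 10)
    (Cmd.Ensures.setReal (by simp [NExp.cost, RExp.cost])
      (by simp [State.setReal, RExp.eval, NExp.eval]))
    ?_ (by omega)
  intro s₁ hf₁ h₁
  refine Cmd.Ensures.seq (T := 60 * (n + 1)) (T' := 10)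
    (P := fun s' => s'.real 9 0 = nextKey (· ∈ unmarked n s) key (s.real 8 0) n)
    (Cmd.Ensures.forTo (n := n) (T := 45)
      (fun m s' => s'.real 9 0 = nextKey (· ∈ unmarked n s) key (s.real 8 0) m)
      (by decide) ?_ ?_ ?_ (by simp only [NExp.cost]; omega)) ?_ le_rfl
  · intro s' hf
    simp only [NExp.eval]
    rw [hf.1 0 (by decide), hf₁.1 0 (by decide), hn]
  · simpa [State.setNat, nextKey] using h₁
  · intro m hm s' hf hc hinv
    have h4 : s'.nat 4 = s.nat 4 := by rw [hf.1 4 (by decide), hf₁.1 4 (by decide)]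
    have h9 : s'.nat 9 = s.nat 9 := by rw [hf.1 9 (by decide), hf₁.1 9 (by decide)]
    have h6 : s'.real 6 = s.real 6 := by rw [hf.2 6 (by decide), hf₁.2 6 (by decide)]
    have h8 : s'.real 8 = s.real 8 := by rw [hf.2 8 (by decide), hf₁.2 8 (by decide)]
    have hmem : m ∈ unmarked n s ↔ s.nat 4 m = 0 := by simp [mem_unmarked, hm]
    have hk := hkey m hm
    refine Cmd.Ensures.ite (T := 10) (fun hb => ?_) (fun hb => ?_)
      (by simp [BExp.cost, NExp.cost, RExp.cost, currentKey])
    all_goals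
      simp only [BExp.eval, NExp.eval, RExp.eval, currentKey, hc, h4, h9, h6, h8, hk, hinv,
        Nat.le_zero, ← hmem] at hb
      rw [not_and_or (a := ¬ _), not_not, not_le, not_le] at hb
    · refine Cmd.Ensures.setReal (by simp [NExp.cost, RExp.cost, currentKey]) ?_
      rw [nextKey, if_pos hb]
      simp [State.setNat, State.setReal, currentKey, RExp.eval, NExp.eval, hc, h9, h6, hk]
    · refine Cmd.Ensures.skip (by norm_num) ?_
      rw [nextKey, if_neg hb]
      simpa [State.setNat] using hinv
  · intro s₂ hf₂ h₂
    refine Cmd.Ensures.setReal (by simp [NExp.cost, RExp.cost]) ?_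
    simp [State.setReal, RExp.eval, NExp.eval, h₂]

/-- Compute the key that defines the candidate line. -/
def candidateKey : Cmd := .forTo 12 (.read 5 (.add (.var 11) (.const 2))) stepKey

theorem candidateKey_ensures {s : State} {n q : ℕ} {key : ℕ → ℝ} (hn : s.nat 0 0 = n)
    (hkey : ∀ j < n, s.real 6 (s.nat 9 0 + j) = key j) (hq : s.nat 5 (s.nat 11 0 + 2) = q) :
    candidateKey.Ensures s (q * (80 * (n + 1) + 20) + 20) fun s' =>
      s'.real 8 0 = (fun u => nextKey (· ∈ unmarked n s) key u n)^[q] (s.real 8 0) := by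
  refine Cmd.Ensures.forTo (n := q) (T := 80 * (n + 1))
    (fun m s' => s'.real 8 0 = (fun u => nextKey (· ∈ unmarked n s) key u n)^[m] (s.real 8 0))
    (by decide) ?_ ?_ ?_ (Nat.add_le_add (Nat.mul_le_mul_left _ (by simp only [NExp.cost]; omega))
      (by simp only [NExp.cost]; omega))
  · intro s' hf
    simp only [NExp.eval]
    rw [hf.1 5 (by decide), hf.1 11 (by decide), hq]
  · simp [State.setNat]
  · intro m hm s' hf hc hinv
    refine (stepKey_ensures (n := n) (key := key) ?_ ?_).mono le_rfl ?_
    · rw [hf.1 0 (by decide), hn]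
    · rw [hf.1 9 (by decide), hf.2 6 (by decide)]
      exact hkey
    · intro s'' _ h
      rw [unmarked_congr (hf.1 4 (by decide)), hinv] at h
      rw [Function.iterate_succ_apply']
      simpa [State.setNat] using h

/-- Mark the items that are hit by the candidate line. -/
def markHits : Cmd :=
  .forTo 7 (.var 0)
    (.ite (.and (.realLe (.read 8 (.const 0)) currentKey)
        (.realLe currentKey (.add (.read 8 (.const 0)) (.read 7 (.read 5 (.var 11))))))
      (.setNat 4 (.var 7) (.const 1)) .skip)

open Classical in
theorem markHits_ensures {s : State} {n i : ℕ} {I : Intervals} (hn : s.nat 0 0 = n)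
    (hkey : ∀ j < n, s.real 6 (s.nat 9 0 + j) = I.key i j)
    (hw : s.real 7 (s.nat 5 (s.nat 11 0)) = I.w i) :
    markHits.Ensures s (80 * (n + 1)) fun s' =>
      unmarked n s' = (unmarked n s).filter fun j => ¬ I.Hits (i, s.real 8 0) j := by
  refine (Cmd.Ensures.forTo (n := n) (T := 40)
    (fun m s' => ∀ j, s'.nat 4 j = 0 ↔ s.nat 4 j = 0 ∧ ¬ (j < m ∧ I.Hits (i, s.real 8 0) j))
    (by decide) ?_ ?_ ?_ le_rfl).mono ?_ ?_
  · intro s' hf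
    simp only [NExp.eval]
    rw [hf.1 0 (by decide), hn]
  · simp [State.setNat]
  · intro m hm s' hf hc hinv
    have h9 : s'.nat 9 = s.nat 9 := by rw [hf.1 9 (by decide)]
    have h5 : s'.nat 5 = s.nat 5 := by rw [hf.1 5 (by decide)]
    have h11 : s'.nat 11 = s.nat 11 := by rw [hf.1 11 (by decide)]
    have h6 : s'.real 6 = s.real 6 := by rw [hf.2 6 (by decide)]
    have h7 : s'.real 7 = s.real 7 := by rw [hf.2 7 (by decide)]
    have h8 : s'.real 8 = s.real 8 := by rw [hf.2 8 (by decide)]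
    have hk := hkey m hm
    have hiff : ∀ j, (j < m + 1 ∧ I.Hits (i, s.real 8 0) j) ↔
        (j < m ∧ I.Hits (i, s.real 8 0) j) ∨ (j = m ∧ I.Hits (i, s.real 8 0) m) := by
      intro j
      constructor
      · rintro ⟨h, h'⟩
        rcases Nat.lt_succ_iff_lt_or_eq.1 h with h | rfl
        · exact Or.inl ⟨h, h'⟩
        · exact Or.inr ⟨rfl, h'⟩
      · rintro (⟨h, h'⟩ | ⟨rfl, h'⟩)
        · exact ⟨by omega, h'⟩
        · exact ⟨by omega, h'⟩
    have hb' : (BExp.and (.realLe (.read 8 (.const 0)) currentKey)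
        (.realLe currentKey (.add (.read 8 (.const 0)) (.read 7 (.read 5 (.var 11)))))).eval s' ↔
        I.Hits (i, s.real 8 0) m := by
      simp only [BExp.eval, NExp.eval, RExp.eval, currentKey, hc, h9, h5, h11, h6, h7, h8, hk, hw,
        Intervals.Hits]
    refine Cmd.Ensures.ite (T := 10) (fun hb => ?_) (fun hb => ?_)
      (by simp [BExp.cost, NExp.cost, RExp.cost, currentKey])
    · refine Cmd.Ensures.setNat (by simp [NExp.cost]) fun j => ?_
      rw [hb'] at hb
      rw [hiff]
      by_cases hj : j = m
      · subst hj
        simp [State.setNat, NExp.eval, hc, hb]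
      · simpa [State.setNat, NExp.eval, hc, hj] using hinv j
    · refine Cmd.Ensures.skip (by norm_num) fun j => ?_
      rw [hb'] at hb
      rw [hiff]
      simpa [State.setNat, hb] using hinv j
  · simp only [NExp.cost]
    omega
  · intro s' _ h
    ext j
    simp only [mem_unmarked, Finset.mem_filter, h]
    constructor
    · rintro ⟨h1, h2, h3⟩
      exact ⟨⟨h1, h2⟩, fun h4 => h3 ⟨h1, h4⟩⟩
    · rintro ⟨⟨h1, h2⟩, h3⟩
      exact ⟨h1, h2, fun h4 => h3 h4.2⟩

/-- Apply the candidate line whose parameters are given by the current digits. -/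
def applyCandidate : Cmd :=
  .seq pickItem (.seq computeBase (.seq startKey (.seq candidateKey markHits)))

theorem applyCandidate_ensures {s : State} {n k c r i a q : ℕ} {I : Intervals}
    (hI : Loaded I n k c r s) (hi : s.nat 5 (s.nat 11 0) = i)
    (ha : s.nat 5 (s.nat 11 0 + 1) = a) (hq : s.nat 5 (s.nat 11 0 + 2) = q) (hir : i < r) :
    applyCandidate.Ensures s (100 * ((n + 1) * (i + a + q + 5))) fun s' =>
      unmarked n s' = I.reduce n (unmarked n s) i a q := by
  have hx (hn0 : 0 < n) : (unmarked n s).sup id < n :=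
    (Finset.sup_lt_iff hn0).2 fun j hj => (mem_unmarked.1 hj).1
  refine Cmd.Ensures.seq (pickItem_ensures hI.n_eq) (T' := 40 * (i + 1) + (40 * (a + 1) +
    (q * (80 * (n + 1) + 20) + 20 + 80 * (n + 1)))) ?_ ?_
  · intro s₁ hf₁ h₁
    refine Cmd.Ensures.seq (computeBase_ensures (n := n) (i := i) ?_ ?_) ?_ le_rfl
    · rw [hf₁.1 0 (by decide), hI.n_eq]
    · rw [hf₁.1 5 (by decide), hf₁.1 11 (by decide), hi]
    intro s₂ hf₂ h₂
    refine Cmd.Ensures.seq (startKey_ensures (a := a) ?_) ?_ le_rfl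
    · rw [hf₂.1 5 (by decide), hf₁.1 5 (by decide), hf₂.1 11 (by decide), hf₁.1 11 (by decide), ha]
    intro s₃ hf₃ h₃
    have hL₃ : Loaded I n k c r s₃ :=
      ((hI.of_frame hf₁ (by decide)).of_frame hf₂ (by decide)).of_frame hf₃ (by decide)
    have h9 : s₃.nat 9 0 = i * n := by rw [hf₃.1 9 (by decide), h₂]
    have h5 : s₃.nat 5 = s.nat 5 := by
      rw [hf₃.1 5 (by decide), hf₂.1 5 (by decide), hf₁.1 5 (by decide)]
    have h4 : s₃.nat 4 = s.nat 4 := by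
      rw [hf₃.1 4 (by decide), hf₂.1 4 (by decide), hf₁.1 4 (by decide)]
    have h11 : s₃.nat 11 = s.nat 11 := by
      rw [hf₃.1 11 (by decide), hf₂.1 11 (by decide), hf₁.1 11 (by decide)]
    have h8 (hn0 : 0 < n) : s₃.real 8 0 =
        I.key i ((unmarked n s).sup id) - (a + 1 : ℕ) * I.w i := by
      rw [h₃, h₂, hf₂.1 8 (by decide), h₁, hf₂.2 6 (by decide), hf₁.2 6 (by decide),
        hI.key_eq i hir _ (hx hn0), hf₂.2 7 (by decide), hf₁.2 7 (by decide), hf₂.1 5 (by decide),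
        hf₁.1 5 (by decide), hf₂.1 11 (by decide), hf₁.1 11 (by decide), hi, hI.w_eq i hir]
    refine Cmd.Ensures.seq (candidateKey_ensures (n := n) (key := I.key i) (q := q) hL₃.n_eq ?_ ?_)
      ?_ le_rfl
    · rw [h9]
      exact hL₃.key_eq i hir
    · rw [h5, h11, hq]
    intro s₄ hf₄ h₄
    have hL₄ := hL₃.of_frame hf₄ (by decide)
    refine (markHits_ensures (n := n) (i := i) (I := I) hL₄.n_eq ?_ ?_).mono le_rfl ?_
    · rw [hf₄.1 9 (by decide), h9]
      exact hL₄.key_eq i hir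
    · rw [hf₄.1 5 (by decide), h5, hf₄.1 11 (by decide), h11, hi, hL₄.w_eq i hir]
    · intro s₅ hf₅ h₅
      rcases n.eq_zero_or_pos with rfl | hn0
      · have he : ∀ s, unmarked 0 s = ∅ := fun s => by simp [unmarked]
        rw [he, he]
        exact (Finset.subset_empty.1 Intervals.reduce_subset).symm
      rw [h₅, h₄, h8 hn0, unmarked_congr h4, unmarked_congr (hf₄.1 4 (by decide)),
        unmarked_congr h4]
      rfl
  · nlinarith [Nat.zero_le (n * i), Nat.zero_le (n * a), Nat.zero_le (n * q)]

/-- Apply the candidate lines whose parameters are given by the digits. -/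
def evaluate : Cmd :=
  .seq (.forTo 7 (.var 0) (.setNat 4 (.var 7) (.const 0)))
    (.seq (.setNat 11 (.const 0) (.var 17))
      (.forTo 10 (.var 1)
        (.seq (.setNat 11 (.const 0) (.sub (.var 11) (.const 3))) applyCandidate)))

theorem evaluate_ensures {s : State} {n k c r : ℕ} {I : Intervals} (hI : Loaded I n k c r s)
    (h17 : s.nat 17 0 = 3 * k)
    (hd : ∀ e < 3 * k, s.nat 5 e < Intervals.choices r c e) :
    evaluate.Ensures s (200 * ((n + 1) * (r + 4 * k + 4 * (c * k) + 5) * (k + 1))) fun s' =>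
      unmarked n s' = I.remaining n (s.nat 5) k (Finset.range n) := by
  set M := (n + 1) * (r + 4 * k + 4 * (c * k) + 5) with hM
  have hM5 : 5 * (n + 1) ≤ M := by
    rw [hM, mul_comm]
    exact Nat.mul_le_mul_left _ (by omega)
  refine Cmd.Ensures.seq (P := fun s' => ∀ j < n, s'.nat 4 j = 0) (T := 30 * (n + 1))
    (T' := 5 + (k * (100 * M + 30) + 20))
    (Cmd.Ensures.forTo (n := n) (T := 5) (fun m s' => ∀ j < m, s'.nat 4 j = 0)
      (by decide) ?_ (by simp) ?_ (by simp only [NExp.cost]; omega)) ?_ ?_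
  · intro s' hf
    simp only [NExp.eval]
    rw [hf.1 0 (by decide), hI.n_eq]
  · intro m hm s' hf hc hinv
    refine Cmd.Ensures.setNat (by simp [NExp.cost]) fun j hj => ?_
    by_cases h : j = m
    · subst h
      simp [State.setNat, NExp.eval, hc]
    · simpa [State.setNat, NExp.eval, hc, h] using hinv j (by omega)
  · intro s₁ hf₁ h₁
    refine Cmd.Ensures.seq (P := fun s' => s' = s₁.setNat 11 0 (3 * k)) (T := 5)
      (T' := k * (100 * M + 30) + 20)
      (Cmd.Ensures.setNat (by simp [NExp.cost])
        (by simp only [NExp.eval]; rw [hf₁.1 17 (by decide), h17])) ?_ le_rfl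
    rintro s₂ hf₂ rfl
    refine (Cmd.Ensures.forTo (n := k) (T := 100 * M + 6) (fun m s' => s'.nat 11 0 = 3 * (k - m) ∧
      I.remaining n (s.nat 5) (k - m) (unmarked n s') =
        I.remaining n (s.nat 5) k (Finset.range n)) (by decide) ?_ ⟨?_, ?_⟩ ?_ le_rfl).mono ?_ ?_
    · intro s' hf
      simp only [NExp.eval]
      rw [hf.1 1 (by decide), hf₂.1 1 (by decide), hf₁.1 1 (by decide), hI.k_eq]
    · simp [State.setNat]
    · congr 1
      ext j
      simp only [mem_unmarked, Finset.mem_range, and_iff_left_iff_imp]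
      simpa [State.setNat] using h₁ j
    · rintro m hm s' hf hc ⟨hp, hrem⟩
      have h5 : s'.nat 5 = s.nat 5 := by
        rw [hf.1 5 (by decide), hf₂.1 5 (by decide), hf₁.1 5 (by decide)]
      have hL : Loaded I n k c r s' :=
        ((hI.of_frame hf₁ (by decide)).of_frame hf₂ (by decide)).of_frame hf (by decide)
      obtain ⟨κ, hκ⟩ : ∃ κ, k - m = κ + 1 := ⟨k - m - 1, by omega⟩
      have hκk : κ < k := by omega
      rw [hκ] at hp hrem
      refine Cmd.Ensures.seq (P := fun s'' => s'' = s'.setNat 11 0 (3 * κ)) (T := 6)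
        (T' := 100 * M) (Cmd.Ensures.setNat (by simp [NExp.cost])
          (by simp only [NExp.eval, hp]; congr 1)) ?_ (by omega)
      rintro s₃ hf₃ rfl
      have h5' : (s'.setNat 11 0 (3 * κ)).nat 5 = s.nat 5 := by rw [hf₃.1 5 (by decide), h5]
      have h11' : (s'.setNat 11 0 (3 * κ)).nat 11 0 = 3 * κ := by simp [State.setNat]
      have d0 := hd (3 * κ) (by omega)
      have d1 := hd (3 * κ + 1) (by omega)
      have d2 := hd (3 * κ + 2) (by omega)
      rw [Intervals.choices_zero] at d0
      rw [Intervals.choices_one] at d1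
      rw [Intervals.choices_two] at d2
      have hck : c * (κ + 1) ≤ c * k := Nat.mul_le_mul_left _ hκk
      refine (applyCandidate_ensures (I := I) (hL.of_frame hf₃ (by decide)) (by rw [h5', h11'])
        (by rw [h5', h11']) (by rw [h5', h11']) d0).mono ?_ ?_
      · exact Nat.mul_le_mul_left _ (Nat.mul_le_mul_left _ (by omega))
      · intro s₄ hf₄ h₄
        refine ⟨?_, ?_⟩
        · have : k - (m + 1) = κ := by omega
          simp only [State.setNat, this]
          rw [← h11', ← hf₄.1 11 (by decide)]
          simp
        · have : k - (m + 1) = κ := by omega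
          rw [this, ← hrem, unmarked_congr (s := s₄) (by simp [State.setNat]), h₄,
            unmarked_congr (s := s') (by simp [State.setNat])]
          rfl
    · simp only [NExp.cost]
      exact Nat.add_le_add (Nat.mul_le_mul_left _ (by omega)) (by omega)
    · rintro s' hf ⟨-, h⟩
      rw [Nat.sub_self] at h
      exact h
  · have : k * (100 * M + 30) = 100 * (M * k) + 30 * k := by ring
    have h2 : 1 * k ≤ M * k := Nat.mul_le_mul_right _ (by omega)
    have h3 : M * (k + 1) = M * k + M := by ring
    rw [this, h3]
    omega

/-- Give a positive answer if all items are marked. -/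
def checkMarks : Cmd :=
  .seq (.setNat 13 (.const 0) (.const 1))
    (.seq (.forTo 7 (.var 0)
        (.ite (.natLe (.read 4 (.var 7)) (.const 0)) (.setNat 13 (.const 0) (.const 0)) .skip))
      (.ite (.natLe (.const 1) (.var 13)) (.setNat 14 (.const 0) (.const 1)) .skip))

theorem checkMarks_ensures {s : State} {n : ℕ} (hn : s.nat 0 0 = n) :
    checkMarks.Ensures s (60 * (n + 1)) fun s' =>
      s'.nat 14 0 = if unmarked n s = ∅ then 1 else s.nat 14 0 := by
  refine Cmd.Ensures.seq (P := fun s' => s'.nat 13 0 = 1) (T := 3)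
    (T' := 30 * (n + 1) + 10)
    (Cmd.Ensures.setNat le_rfl (by simp [State.setNat, NExp.eval])) ?_ (by omega)
  intro s₁ hf₁ h₁
  refine Cmd.Ensures.seq (T := 30 * (n + 1)) (T' := 10)
    (P := fun s' => s'.nat 13 0 = if unmarked n s = ∅ then 1 else 0)
    (Cmd.Ensures.forTo (n := n) (T := 10)
      (fun m s' => s'.nat 13 0 = if unmarked m s = ∅ then 1 else 0)
      (by decide) ?_ ?_ ?_ (by simp only [NExp.cost]; omega)) ?_ le_rfl
  · intro s' hf
    simp only [NExp.eval]
    rw [hf.1 0 (by decide), hf₁.1 0 (by decide), hn]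
  · simpa [State.setNat, unmarked] using h₁
  · intro m hm s' hf hc hinv
    have h4 : s'.nat 4 = s.nat 4 := by rw [hf.1 4 (by decide), hf₁.1 4 (by decide)]
    have hs : unmarked (m + 1) s = if s.nat 4 m = 0 then insert m (unmarked m s)
        else unmarked m s := by
      simp only [unmarked, Finset.range_add_one, Finset.filter_insert]
    refine Cmd.Ensures.ite (T := 3) (fun hb => ?_) (fun hb => ?_) (by simp [BExp.cost, NExp.cost])
    · refine Cmd.Ensures.setNat (by simp [NExp.cost]) ?_
      simp only [BExp.eval, NExp.eval, hc, h4, Nat.le_zero] at hb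
      rw [hs, if_pos hb]
      simp [State.setNat, NExp.eval]
    · refine Cmd.Ensures.skip (by norm_num) ?_
      simp only [BExp.eval, NExp.eval, hc, h4, Nat.le_zero] at hb
      rw [hs, if_neg hb]
      simpa [State.setNat] using hinv
  · intro s₂ hf₂ h₂
    refine Cmd.Ensures.ite (T := 3) (fun hb => ?_) (fun hb => ?_) (by simp [BExp.cost, NExp.cost])
    · refine Cmd.Ensures.setNat (by simp [NExp.cost]) ?_
      simp only [BExp.eval, NExp.eval, h₂] at hb
      split_ifs at hb ⊢ <;> simp_all [State.setNat, NExp.eval]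
    · refine Cmd.Ensures.skip (by norm_num) ?_
      simp only [BExp.eval, NExp.eval, h₂] at hb
      rw [hf₂.1 14 (by decide), hf₁.1 14 (by decide)]
      split_ifs at hb ⊢ <;> simp_all

/-- Proceed to the next combination of digits. -/
def advance : Cmd :=
  .seq (.setNat 16 (.const 0) (.const 1))
    (.forTo 15 (.var 17)
      (.ite (.natLe (.const 1) (.var 16))
        (.ite (.natLe (.read 6 (.var 15)) (.add (.read 5 (.var 15)) (.const 1)))
          (.setNat 5 (.var 15) (.const 0))
          (.seq (.setNat 5 (.var 15) (.add (.read 5 (.var 15)) (.const 1)))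
            (.setNat 16 (.const 0) (.const 0))))
        .skip))

theorem advance_ensures {s : State} {E t : ℕ} {b : ℕ → ℕ} (h17 : s.nat 17 0 = E)
    (hb : ∀ e < E, 0 < b e) (h6 : ∀ e < E, s.nat 6 e = b e)
    (h5 : ∀ e < E, s.nat 5 e = digit b t e) :
    advance.Ensures s (60 * (E + 1)) fun s' => (∀ e < E, s'.nat 5 e = digit b (t + 1) e) ∧
      s'.nat 16 0 = if (∏ i ∈ Finset.range E, b i) ∣ t + 1 then 1 else 0 := by
  refine Cmd.Ensures.seq (P := fun s' => s'.nat 16 0 = 1) (T := 3)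
    (T' := 50 * (E + 1))
    (Cmd.Ensures.setNat le_rfl (by simp [State.setNat, NExp.eval])) ?_ (by omega)
  intro s₁ hf₁ h₁
  refine (Cmd.Ensures.forTo (n := E) (T := 31)
    (fun m s' => (∀ e < m, s'.nat 5 e = digit b (t + 1) e) ∧
      (∀ e < E, m ≤ e → s'.nat 5 e = digit b t e) ∧
      s'.nat 16 0 = if (∏ i ∈ Finset.range m, b i) ∣ t + 1 then 1 else 0)
      (by decide) ?_ ?_ ?_ le_rfl).mono ?_ (fun s' _ h => ⟨h.1, h.2.2⟩)
  · intro s' hf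
    simp only [NExp.eval]
    rw [hf.1 17 (by decide), hf₁.1 17 (by decide), h17]
  · refine ⟨by simp, fun e he _ => ?_, by simpa [State.setNat] using h₁⟩
    have := hf₁.1 5 (by decide)
    simpa [State.setNat, this] using h5 e he
  · rintro m hm s' hf hc ⟨hlo, hhi, hcarry⟩
    have h6' : s'.nat 6 m = b m := by
      rw [hf.1 6 (by decide), hf₁.1 6 (by decide), h6 m hm]
    have h5' := hhi m hm le_rfl
    have hbm : ∀ i ≤ m, 0 < b i := fun i hi => hb i (by omega)
    refine Cmd.Ensures.ite (T := 26) (fun hb => ?_) (fun hb => ?_) (by simp [BExp.cost, NExp.cost])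
    · have hdvd : (∏ i ∈ Finset.range m, b i) ∣ t + 1 := by
        by_contra h
        simp [BExp.eval, NExp.eval, hcarry, h] at hb
      have hd := digit_succ_of_dvd hbm hdvd
      have hp := prod_dvd_succ_iff hbm hdvd
      refine Cmd.Ensures.ite (T := 15) (fun hb' => ?_) (fun hb' => ?_)
        (by simp [BExp.cost, NExp.cost])
      · simp only [BExp.eval, NExp.eval, hc, h6', h5'] at hb'
        rw [if_pos hb'] at hd
        refine Cmd.Ensures.setNat (by simp [NExp.cost]) ⟨fun e he => ?_, fun e he hme => ?_, ?_⟩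
        · by_cases h : e = m
          · subst h
            simp [State.setNat, NExp.eval, hc, hd]
          · simpa [State.setNat, NExp.eval, hc, h] using hlo e (by omega)
        · simpa [State.setNat, NExp.eval, hc, show e ≠ m by omega] using hhi e he (by omega)
        · rw [if_pos (hp.2 hb')]
          simpa [State.setNat, hdvd] using hcarry
      · simp only [BExp.eval, NExp.eval, hc, h6', h5'] at hb'
        rw [if_neg hb'] at hd
        refine Cmd.Ensures.seq (P := fun s'' => s'' = s'.setNat 5 m (digit b t m + 1)) (T := 10)
          (T' := 3) (Cmd.Ensures.setNat (by simp [NExp.cost])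
            (by simp only [NExp.eval, hc, h5'])) ?_ (by norm_num)
        rintro s'' - rfl
        refine Cmd.Ensures.setNat (by simp [NExp.cost]) ⟨fun e he => ?_, fun e he hme => ?_, ?_⟩
        · by_cases h : e = m
          · subst h
            simp [State.setNat, hd]
          · simpa [State.setNat, h] using hlo e (by omega)
        · simpa [State.setNat, show e ≠ m by omega] using hhi e he (by omega)
        · rw [if_neg fun h => hb' (hp.1 h)]
          simp [State.setNat, NExp.eval]
    · have hdvd : ¬ (∏ i ∈ Finset.range m, b i) ∣ t + 1 := by
        intro h
        simp [BExp.eval, NExp.eval, hcarry, h] at hb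
      have hd := digit_succ_of_not_dvd hdvd
      refine Cmd.Ensures.skip (by norm_num) ⟨fun e he => ?_, fun e he hme => ?_, ?_⟩
      · rcases Nat.lt_succ_iff_lt_or_eq.1 he with he | rfl
        · simpa [State.setNat] using hlo e he
        · simpa [State.setNat, hd] using h5'
      · simpa [State.setNat] using hhi e he (by omega)
      · have : ¬ (∏ i ∈ Finset.range (m + 1), b i) ∣ t + 1 := fun h =>
          hdvd ((Finset.prod_dvd_prod_of_subset _ _ _
            (Finset.range_subset_range.2 (Nat.le_succ m))).trans h)
        rw [if_neg this]
        simpa [State.setNat, hdvd] using hcarry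
  · simp only [NExp.cost]
    omega

/-- Try all combinations of digits. -/
def search : Cmd :=
  .seq (.setNat 16 (.const 0) (.const 0))
    (.loop (.natLe (.var 16) (.const 0)) (.seq evaluate (.seq checkMarks advance)))

open Classical in
theorem search_ensures {s : State} {n k c r : ℕ} {I : Intervals} (hI : Loaded I n k c r s)
    (hr : 1 ≤ r) (hc : 1 ≤ c) (h17 : s.nat 17 0 = 3 * k)
    (h6 : ∀ e < 3 * k, s.nat 6 e = Intervals.choices r c e)
    (h5 : ∀ e < 3 * k, s.nat 5 e = 0) (h14 : s.nat 14 0 = 0) :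
    search.Ensures s ((∏ e ∈ Finset.range (3 * k), Intervals.choices r c e) *
      (500 * ((n + 1) * (r + 4 * k + 4 * (c * k) + 5) * (k + 1))) + 10) fun s' =>
        s'.nat 14 0 = if ∃ dig : ℕ → ℕ, (∀ e < 3 * k, dig e < Intervals.choices r c e) ∧
          I.remaining n dig k (Finset.range n) = ∅ then 1 else 0 := by
  set b := Intervals.choices r c
  set N := ∏ e ∈ Finset.range (3 * k), b e with hN
  set M := (n + 1) * (r + 4 * k + 4 * (c * k) + 5) * (k + 1) with hM
  have hb : ∀ e, 0 < b e := Intervals.choices_pos hr hc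
  have hN0 : 0 < N := Finset.prod_pos fun e _ => hb e
  have hM1 : (n + 1) * 5 * (k + 1) ≤ M := by
    rw [hM]
    gcongr
    omega
  have hM2 : n + k + 1 ≤ (n + 1) * (k + 1) := by nlinarith [Nat.zero_le (n * k)]
  have hM3 : 5 * (n + k + 1) ≤ M := by
    refine le_trans ?_ hM1
    calc 5 * (n + k + 1) ≤ 5 * ((n + 1) * (k + 1)) := Nat.mul_le_mul_left _ hM2
      _ = _ := by ring
  refine Cmd.Ensures.seq (P := fun s' => s' = s.setNat 16 0 0) (T := 3)
    (T' := N * (500 * M) + 7) (Cmd.Ensures.setNat le_rfl rfl) ?_ (by omega)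
  rintro s₁ hf₁ rfl
  refine (Cmd.Ensures.loop (N := N) (T := 350 * M)
    (fun t s' => (∀ e < 3 * k, s'.nat 5 e = digit b t e) ∧
      (s'.nat 16 0 = if N ∣ t ∧ 0 < t then 1 else 0) ∧
      s'.nat 14 0 = if ∃ u < t, I.remaining n (digit b u) k (Finset.range n) = ∅ then 1 else 0)
    ⟨?_, ?_, ?_⟩ ?_ ?_).mono ?_ ?_
  · intro e he
    simpa [State.setNat, digit_zero] using h5 e he
  · simp [State.setNat]
  · simpa [State.setNat] using h14
  · rintro t ht s' hf ⟨i5, i16, i14⟩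
    have hI' : Loaded I n k c r s' := (hI.of_frame hf₁ (by decide)).of_frame hf (by decide)
    have h17' : s'.nat 17 0 = 3 * k := by rw [hf.1 17 (by decide), hf₁.1 17 (by decide), h17]
    refine ⟨?_, ?_⟩
    · have : ¬ (N ∣ t ∧ 0 < t) := fun h => absurd (Nat.le_of_dvd h.2 h.1) (not_le.2 ht)
      simp [BExp.eval, NExp.eval, i16, this]
    · refine Cmd.Ensures.seq (evaluate_ensures hI' h17' fun e he => ?_)
        (T' := 60 * (n + 1) + 60 * (3 * k + 1)) ?_ (by rw [← hM]; omega)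
      · rw [i5 e he]
        exact digit_lt (hb e) t
      intro s₂ hf₂ h₂
      refine Cmd.Ensures.seq (checkMarks_ensures (n := n) ?_) ?_ le_rfl
      · rw [hf₂.1 0 (by decide), hI'.n_eq]
      intro s₃ hf₃ h₃
      refine (advance_ensures (E := 3 * k) (t := t) (b := b) ?_ (fun e _ => hb e) ?_ ?_).mono
        le_rfl ?_
      · rw [hf₃.1 17 (by decide), hf₂.1 17 (by decide), h17']
      · rw [hf₃.1 6 (by decide), hf₂.1 6 (by decide), hf.1 6 (by decide), hf₁.1 6 (by decide)]
        exact h6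
      · rw [hf₃.1 5 (by decide), hf₂.1 5 (by decide)]
        exact i5
      · rintro s₄ hf₄ ⟨j5, j16⟩
        refine ⟨j5, by simpa using j16, ?_⟩
        rw [hf₄.1 14 (by decide), h₃, h₂, hf₂.1 14 (by decide), i14,
          Intervals.remaining_congr i5]
        have hiff : (∃ u < t + 1, I.remaining n (digit b u) k (Finset.range n) = ∅) ↔
            I.remaining n (digit b t) k (Finset.range n) = ∅ ∨
            ∃ u < t, I.remaining n (digit b u) k (Finset.range n) = ∅ := by
          constructor
          · rintro ⟨u, hu, h⟩
            rcases Nat.lt_succ_iff_lt_or_eq.1 hu with hu | rfl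
            · exact Or.inr ⟨u, hu, h⟩
            · exact Or.inl h
          · rintro (h | ⟨u, hu, h⟩)
            · exact ⟨t, by omega, h⟩
            · exact ⟨u, by omega, h⟩
        by_cases h : I.remaining n (digit b t) k (Finset.range n) = ∅ <;>
          simp only [hiff, h, true_or, false_or, if_true, if_false]
  · rintro s' hf ⟨-, i16, -⟩
    simp [BExp.eval, NExp.eval, i16, hN0]
  · simp only [BExp.cost, NExp.cost]
    exact Nat.add_le_add (Nat.mul_le_mul_left _ (by omega)) (by omega)
  · rintro s' hf ⟨-, -, i14⟩
    rw [i14]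
    congr 1
    apply propext
    constructor
    · rintro ⟨u, -, h⟩
      exact ⟨digit b u, fun e _ => digit_lt (hb e) u, h⟩
    · rintro ⟨dig, hd, h⟩
      obtain ⟨t, ht, he⟩ := exists_digit_eq _ dig hd
      exact ⟨t, ht, by rwa [Intervals.remaining_congr he]⟩

/-- Store the numbers of choices for the digits. -/
def storeChoices : Cmd :=
  .seq (.setNat 17 (.const 0) (.const 0))
    (.seq (.setNat 19 (.const 0) (.const 0))
      (.seq (.setNat 20 (.const 0) (.const 0))
        (.forTo 18 (.var 1)
          (.seq (.setNat 6 (.var 17) (.var 3))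
            (.seq (.setNat 19 (.const 0) (.add (.var 19) (.const 4)))
              (.seq (.setNat 6 (.add (.var 17) (.const 1)) (.var 19))
                (.seq (.setNat 20 (.const 0) (.add (.var 20)
                    (.add (.add (.var 2) (.var 2)) (.add (.var 2) (.var 2)))))
                  (.seq (.setNat 6 (.add (.var 17) (.const 2)) (.var 20))
                    (.setNat 17 (.const 0) (.add (.var 17) (.const 3)))))))))))

theorem storeChoices_ensures {s : State} {k c r : ℕ} (hk : s.nat 1 0 = k) (hc : s.nat 2 0 = c)
    (hr : s.nat 3 0 = r) :
    storeChoices.Ensures s (100 * (k + 1)) fun s' => s'.nat 17 0 = 3 * k ∧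
      ∀ e < 3 * k, s'.nat 6 e = Intervals.choices r c e := by
  refine Cmd.Ensures.seq (P := fun s' => s' = s.setNat 17 0 0) (T := 3) (T' := 80 * (k + 1) + 6)
    (Cmd.Ensures.setNat le_rfl rfl) ?_ (by omega)
  rintro s₁ hf₁ rfl
  refine Cmd.Ensures.seq (P := fun s' => s' = (s.setNat 17 0 0).setNat 19 0 0) (T := 3)
    (T' := 80 * (k + 1) + 3) (Cmd.Ensures.setNat le_rfl rfl) ?_ (by omega)
  rintro s₁ - rfl
  refine Cmd.Ensures.seq (P := fun s' => s' = ((s.setNat 17 0 0).setNat 19 0 0).setNat 20 0 0)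
    (T := 3) (T' := 80 * (k + 1)) (Cmd.Ensures.setNat le_rfl rfl) ?_ (by omega)
  rintro s₁ - rfl
  refine (Cmd.Ensures.forTo (n := k) (T := 60) (fun m s' => s'.nat 17 0 = 3 * m ∧
    s'.nat 19 0 = 4 * m ∧ s'.nat 20 0 = 4 * (c * m) ∧
      ∀ e < 3 * m, s'.nat 6 e = Intervals.choices r c e) (by decide) ?_ ?_ ?_ le_rfl).mono ?_
    (fun s' _ h => ⟨h.1, h.2.2.2⟩)
  · intro s' hf
    simp only [NExp.eval]
    rw [hf.1 1 (by decide)]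
    simpa [State.setNat] using hk
  · simp [State.setNat]
  · rintro m hm s' hf hcnt ⟨i17, i19, i20, i6⟩
    have h2 : s'.nat 2 0 = c := by
      rw [hf.1 2 (by decide)]
      simpa [State.setNat] using hc
    have h3 : s'.nat 3 0 = r := by
      rw [hf.1 3 (by decide)]
      simpa [State.setNat] using hr
    refine ⟨_, _, Run.seq (Run.setNat _ _ _ _) (Run.seq (Run.setNat _ _ _ _) (Run.seq
      (Run.setNat _ _ _ _) (Run.seq (Run.setNat _ _ _ _) (Run.seq (Run.setNat _ _ _ _)
      (Run.setNat _ _ _ _))))), by simp [NExp.cost], ?_⟩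
    have e0 := Intervals.choices_zero r c m
    have e1 := Intervals.choices_one r c m
    have e2 := Intervals.choices_two r c m
    refine ⟨?_, ?_, ?_, fun e he => ?_⟩
    · simp [State.setNat, NExp.eval, i17]
      ring
    · simp [State.setNat, NExp.eval, i19]
      ring
    · simp [State.setNat, NExp.eval, i20, h2]
      ring
    · by_cases c2 : e = 3 * m + 2
      · subst c2
        simp [State.setNat, NExp.eval, i17, i20, h2, e2]
        ring
      by_cases c1 : e = 3 * m + 1
      · subst c1
        simp [State.setNat, NExp.eval, i17, i19, e1]
        ring
      by_cases c0 : e = 3 * m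
      · subst c0
        simp [State.setNat, NExp.eval, i17, h3, e0]
      · simpa [State.setNat, NExp.eval, i17, c0, c1, c2] using i6 e (by omega)
  · simp only [NExp.cost]
    omega

/-- Decide whether `k` lines can hit all items. -/
def decideCoverable : Cmd :=
  .seq storeChoices (.seq search (.setNat 0 (.const 0) (.var 14)))

open Classical in
theorem decideCoverable_ensures {s : State} {n k c r : ℕ} {I : Intervals}
    (hI : Loaded I n k c r s) (hr : 1 ≤ r) (hc : 1 ≤ c) (hw : ∀ i < r, 0 ≤ I.w i)
    (hsh : I.Shallow r c (Finset.range n)) (h5 : ∀ e, s.nat 5 e = 0) (h14 : s.nat 14 0 = 0) :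
    decideCoverable.Ensures s (1000 * ((∏ e ∈ Finset.range (3 * k), Intervals.choices r c e) *
      ((n + 1) * (r + 4 * k + 4 * (c * k) + 5) * (k + 1)))) fun s' =>
        s'.nat 0 0 = if I.Coverable r (Finset.range n) k then 1 else 0 := by
  refine Cmd.Ensures.seq (storeChoices_ensures hI.k_eq hI.c_eq hI.r_eq)
    (T' := (∏ e ∈ Finset.range (3 * k), Intervals.choices r c e) *
      (500 * ((n + 1) * (r + 4 * k + 4 * (c * k) + 5) * (k + 1))) + 10 + 4) ?_ ?_
  · rintro s₁ hf₁ ⟨h17, h6⟩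
    refine Cmd.Ensures.seq (search_ensures (hI.of_frame hf₁ (by decide)) hr hc h17 h6 ?_ ?_) ?_
      le_rfl
    · rw [hf₁.1 5 (by decide)]
      exact fun e _ => h5 e
    · rw [hf₁.1 14 (by decide), h14]
    · intro s₂ hf₂ h₂
      refine Cmd.Ensures.setNat (by simp [NExp.cost]) ?_
      rw [Intervals.coverable_iff_exists_remaining (fun j hj => Finset.mem_range.1 hj) hr hc hw
        hsh, ← h₂]
      simp [State.setNat, NExp.eval]
  · set N := ∏ e ∈ Finset.range (3 * k), Intervals.choices r c e
    have hN : 1 ≤ N := Finset.prod_pos fun e _ => Intervals.choices_pos hr hc e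
    have h1 : k + 1 ≤ (n + 1) * (r + 4 * k + 4 * (c * k) + 5) * (k + 1) :=
      Nat.le_mul_of_pos_left _ (by positivity)
    set M := (n + 1) * (r + 4 * k + 4 * (c * k) + 5) * (k + 1)
    have h2 : 1 * M ≤ N * M := Nat.mul_le_mul_right _ hN
    have h3 : N * (500 * M) = 500 * (N * M) := by ring
    omega

theorem level_add (d x y : Plane) : level d (x + y) = level d x + level d y := by
  simp [level]
  ring

theorem level_sub (d x y : Plane) : level d (x - y) = level d x - level d y := by
  simp [level]
  ring

theorem continuous_level (d : Plane) : Continuous (level d) := by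
  unfold level
  fun_prop

theorem sq_add_sq_ne_zero {d : Plane} (hd : d ≠ 0) : d 0 ^ 2 + d 1 ^ 2 ≠ 0 := by
  intro h
  apply hd
  have h0 : d 0 = 0 := by nlinarith [sq_nonneg (d 0), sq_nonneg (d 1)]
  have h1 : d 1 = 0 := by nlinarith [sq_nonneg (d 0), sq_nonneg (d 1)]
  ext i
  fin_cases i
  · exact h0
  · exact h1

theorem mem_span_singleton_iff_level {d : Plane} (hd : d ≠ 0) (x : Plane) :
    x ∈ Submodule.span ℝ {d} ↔ level d x = 0 := by
  rw [Submodule.mem_span_singleton]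
  constructor
  · rintro ⟨a, rfl⟩
    simp [level]
    ring
  · intro h
    have hne := sq_add_sq_ne_zero hd
    rw [level] at h
    refine ⟨(d 0 * x 0 + d 1 * x 1) / (d 0 ^ 2 + d 1 ^ 2), ?_⟩
    ext i
    fin_cases i
    · simp
      field_simp
      linear_combination d 1 * h
    · simp
      field_simp
      linear_combination (-d 0) * h

/-- The line with direction vector `d` on which `level d` has the value `t`. -/
noncomputable def levelLine (d : Plane) (t : ℝ) : AffineSubspace ℝ Plane :=
  AffineSubspace.mk' ((t / (d 0 ^ 2 + d 1 ^ 2)) • !₂[-d 1, d 0]) (Submodule.span ℝ {d})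

theorem direction_levelLine (d : Plane) (t : ℝ) :
    (levelLine d t).direction = Submodule.span ℝ {d} := AffineSubspace.direction_mk' _ _

theorem mem_levelLine {d : Plane} (hd : d ≠ 0) {t : ℝ} {x : Plane} :
    x ∈ levelLine d t ↔ level d x = t := by
  rw [levelLine, AffineSubspace.mem_mk', vsub_eq_sub, mem_span_singleton_iff_level hd, level_sub,
    sub_eq_zero]
  have : level d ((t / (d 0 ^ 2 + d 1 ^ 2)) • !₂[-d 1, d 0]) = t := by
    have hne := sq_add_sq_ne_zero hd
    simp [level]
    field_simp
  rw [this]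

theorem isDLine_levelLine {r : ℕ} (d : Fin r → Plane) (i : Fin r) (t : ℝ) :
    IsDLine (directions d) (levelLine (d i) t) :=
  ⟨⟨_, AffineSubspace.self_mem_mk' _ _⟩, i, (direction_levelLine _ _).symm⟩

theorem IsDLine.exists_level {r : ℕ} {d : Fin r → Plane} (hd : ∀ i, d i ≠ 0)
    {l : AffineSubspace ℝ Plane} (hl : IsDLine (directions d) l) :
    ∃ i t, ∀ x, x ∈ l ↔ level (d i) x = t := by
  obtain ⟨⟨p, hp⟩, i, hi⟩ := hl
  refine ⟨i, level (d i) p, fun x => ?_⟩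
  rw [← AffineSubspace.vsub_right_mem_direction_iff_mem hp, ← hi, vsub_eq_sub]
  exact (mem_span_singleton_iff_level (hd i) _).trans (by rw [level_sub, sub_eq_zero])

theorem stabs_translate_iff {d : Plane} {O : Set Plane} (hO : IsConnected O) {lo hi : ℝ}
    (hlo : IsLeast (level d '' O) lo) (hhi : IsGreatest (level d '' O) hi) {t : ℝ}
    {l : AffineSubspace ℝ Plane} (hl : ∀ x, x ∈ l ↔ level d x = t) (v : Plane) :
    Stabs l (translate O v) ↔ t - hi ≤ level d v ∧ level d v ≤ t - hi + (hi - lo) := by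
  constructor
  · rintro ⟨_, hx, y, hy, rfl⟩
    have h := (hl _).1 hx
    rw [level_add] at h
    have h1 := hlo.2 ⟨y, hy, rfl⟩
    have h2 := hhi.2 ⟨y, hy, rfl⟩
    constructor <;> linarith
  · rintro ⟨h1, h2⟩
    have hpre := (hO.isPreconnected.image _ (continuous_level d).continuousOn).Icc_subset
      hlo.1 hhi.1
    obtain ⟨y, hy, hyt⟩ := hpre (show t - level d v ∈ Set.Icc lo hi by
      constructor <;> linarith)
    exact ⟨v + y, (hl _).2 (by rw [level_add, hyt]; ring), y, hy, rfl⟩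

section

variable {r n : ℕ} {d : Fin r → Plane} {O : Set Plane} {lo hi : Fin r → ℝ} {v : Fin n → Plane}
  {I : Intervals}

theorem hits_iff_stabs (hO : IsConnected O) (hlo : ∀ i, IsLeast (level (d i) '' O) (lo i))
    (hhi : ∀ i, IsGreatest (level (d i) '' O) (hi i))
    (hkey : ∀ (i : Fin r) (j : Fin n), I.key i j = level (d i) (v j))
    (hw : ∀ i : Fin r, I.w i = hi i - lo i) {l : AffineSubspace ℝ Plane} {i : Fin r} {t : ℝ}
    (hl : ∀ x, x ∈ l ↔ level (d i) x = t) (j : Fin n) :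
    I.Hits (i, t - hi i) j ↔ Stabs l (translate O (v j)) := by
  rw [stabs_translate_iff hO (hlo i) (hhi i) hl, Intervals.Hits, hkey i j, hw i]

theorem stabbable_iff_coverable (hd : ∀ i, d i ≠ 0) (hO : IsConnected O)
    (hlo : ∀ i, IsLeast (level (d i) '' O) (lo i))
    (hhi : ∀ i, IsGreatest (level (d i) '' O) (hi i))
    (hkey : ∀ (i : Fin r) (j : Fin n), I.key i j = level (d i) (v j))
    (hw : ∀ i : Fin r, I.w i = hi i - lo i) (k : ℕ) :
    Stabbable (directions d) (fun j => translate O (v j)) k ↔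
      I.Coverable r (Finset.range n) k := by
  classical
  constructor
  · rintro ⟨L, hk, hL, hstab⟩
    have h : ∀ l : L, ∃ i t, ∀ x, x ∈ (l : AffineSubspace ℝ Plane) ↔ level (d i) x = t :=
      fun l => (hL l l.2).exists_level hd
    choose f g hfg using h
    refine ⟨L.attach.image fun l => ((f l : ℕ), g l - hi (f l)), ?_, ?_, ?_⟩
    · exact Finset.card_image_le.trans (by rwa [Finset.card_attach])
    · intro p hp
      obtain ⟨l, -, rfl⟩ := Finset.mem_image.1 hp
      exact (f l).2
    · intro j hj
      obtain ⟨l, hl, hlj⟩ := hstab ⟨j, Finset.mem_range.1 hj⟩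
      exact ⟨_, Finset.mem_image_of_mem _ (Finset.mem_attach _ ⟨l, hl⟩),
        (hits_iff_stabs hO hlo hhi hkey hw (hfg ⟨l, hl⟩) ⟨j, Finset.mem_range.1 hj⟩).2 hlj⟩
  · rintro ⟨L, hk, hr, hL⟩
    refine ⟨L.attach.image fun l : L =>
      levelLine (d ⟨l.1.1, hr l l.2⟩) (l.1.2 + hi ⟨l.1.1, hr l l.2⟩), ?_, ?_, ?_⟩
    · exact Finset.card_image_le.trans (by rwa [Finset.card_attach])
    · intro l hl
      obtain ⟨p, -, rfl⟩ := Finset.mem_image.1 hl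
      exact isDLine_levelLine d _ _
    · intro j
      obtain ⟨p, hp, hpj⟩ := hL j (Finset.mem_range.2 j.2)
      refine ⟨_, Finset.mem_image_of_mem _ (Finset.mem_attach _ ⟨p, hp⟩),
        (hits_iff_stabs hO hlo hhi hkey hw (fun x => mem_levelLine (hd _)) j).1 ?_⟩
      simpa using hpj

theorem Shallow.intervals (hd : ∀ i, d i ≠ 0)
    (hinj : Function.Injective fun i => Submodule.span ℝ {d i}) (hO : IsConnected O)
    (hlo : ∀ i, IsLeast (level (d i) '' O) (lo i))
    (hhi : ∀ i, IsGreatest (level (d i) '' O) (hi i))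
    (hkey : ∀ (i : Fin r) (j : Fin n), I.key i j = level (d i) (v j))
    (hw : ∀ i : Fin r, I.w i = hi i - lo i) {c : ℕ}
    (h : Shallow c (directions d) fun j => translate O (v j)) :
    I.Shallow r c (Finset.range n) := by
  classical
  rintro ⟨i, u⟩ ⟨i', u'⟩ hi₁ hi₂ hne
  lift i to Fin r using hi₁
  lift i' to Fin r using hi₂
  have h1 := h (levelLine (d i) (u + hi i)) (levelLine (d i') (u' + hi i'))
    (isDLine_levelLine d _ _) (isDLine_levelLine d _ _) (by
      rw [direction_levelLine, direction_levelLine]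
      exact fun he => hne (congrArg Fin.val (hinj he)))
  have hsub : (((Finset.range n).filter fun j => I.Hits (i, u) j ∧ I.Hits (i', u') j : Finset ℕ) :
      Set ℕ) ⊆ Fin.val '' {j : Fin n | Stabs (levelLine (d i) (u + hi i)) (translate O (v j)) ∧
        Stabs (levelLine (d i') (u' + hi i')) (translate O (v j))} := by
    intro j hj
    rw [Finset.mem_coe, Finset.mem_filter, Finset.mem_range] at hj
    obtain ⟨hjn, hj₁, hj₂⟩ := hj
    have hs := fun a t => hits_iff_stabs (I := I) hO hlo hhi hkey hw (i := a)
      (fun x => mem_levelLine (t := t) (hd a)) ⟨j, hjn⟩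
    refine ⟨⟨j, hjn⟩, ⟨(hs _ _).1 ?_, (hs _ _).1 ?_⟩, rfl⟩
    · simpa using hj₁
    · simpa using hj₂
  have h2 := (Set.encard_le_encard hsub).trans ((Set.encard_image_le _ _).trans h1)
  rw [Set.encard_coe_eq_coe_finsetCard] at h2
  convert Nat.cast_le.1 h2

end

/-- Compute the keys and widths of a set of translates. -/
def loadTranslates : Cmd :=
  .seq (.setNat 9 (.const 0) (.const 0))
    (.forTo 12 (.var 3)
      (.seq (.setReal 7 (.var 12) (.sub (.read 3 (.var 12)) (.read 2 (.var 12))))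
        (.seq (.forTo 7 (.var 0) (.setReal 6 (.add (.var 9) (.var 7))
            (.sub (.mul (.read 0 (.var 12)) (.read 5 (.var 7)))
              (.mul (.read 1 (.var 12)) (.read 4 (.var 7))))))
          (.setNat 9 (.const 0) (.add (.var 9) (.var 0))))))

/-- The intervals that are described by the coordinates of direction vectors and translations. -/
def translatesIntervals (s : State) : Intervals where
  key i j := s.real 0 i * s.real 5 j - s.real 1 i * s.real 4 j
  w i := s.real 3 i - s.real 2 i

theorem loadTranslates_ensures {s : State} {n k c r : ℕ} (hn : s.nat 0 0 = n) (hk : s.nat 1 0 = k)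
    (hc : s.nat 2 0 = c) (hr : s.nat 3 0 = r) :
    loadTranslates.Ensures s (100 * ((r + 1) * (n + 1)))
      (Loaded (translatesIntervals s) n k c r) := by
  refine Cmd.Ensures.seq (P := fun s' => s' = s.setNat 9 0 0) (T := 3)
    (T' := r * (50 * (n + 1) + 30) + 20) (Cmd.Ensures.setNat le_rfl rfl) ?_ (by nlinarith)
  rintro s₁ hf₁ rfl
  refine (Cmd.Ensures.forTo (n := r) (T := 50 * (n + 1) + 17) (fun m s' => s'.nat 9 0 = m * n ∧
      (∀ i < m, s'.real 7 i = (translatesIntervals s).w i) ∧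
      ∀ i < m, ∀ j < n, s'.real 6 (i * n + j) = (translatesIntervals s).key i j)
    (by decide) ?_ ?_ ?_ le_rfl).mono ?_ ?_
  · intro s' hf
    simp only [NExp.eval]
    rw [hf.1 3 (by decide), hf₁.1 3 (by decide), hr]
  · simp [State.setNat]
  · rintro m hm s' hf hcnt ⟨i9, i7, i6⟩
    have hread : ∀ a ∈ [0, 1, 2, 3, 4, 5], s'.real a = s.real a := by
      intro a ha
      rw [hf.2 a (by revert a; decide), hf₁.2 a (by revert a; decide)]
    have hn' : s'.nat 0 0 = n := by rw [hf.1 0 (by decide), hf₁.1 0 (by decide), hn]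
    refine Cmd.Ensures.seq (P := fun s'' => s'' = s'.setReal 7 m (s.real 3 m - s.real 2 m))
      (T := 10) (T' := 50 * (n + 1) + 7) (Cmd.Ensures.setReal (by simp [NExp.cost, RExp.cost]) ?_)
      ?_ (by omega)
    · simp only [NExp.eval, RExp.eval, hcnt, hread 2 (by decide), hread 3 (by decide)]
    rintro s₂ hf₂ rfl
    refine Cmd.Ensures.seq (P := fun s'' => (∀ i < m, ∀ j < n, s''.real 6 (i * n + j) =
        (translatesIntervals s).key i j) ∧
        ∀ j < n, s''.real 6 (m * n + j) = (translatesIntervals s).key m j)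
      (T := 50 * (n + 1)) (T' := 7)
      (Cmd.Ensures.forTo (n := n) (T := 25) (fun l s'' => (∀ i < m, ∀ j < n,
        s''.real 6 (i * n + j) = (translatesIntervals s).key i j) ∧
        ∀ j < l, s''.real 6 (m * n + j) = (translatesIntervals s).key m j)
        (by decide) ?_ ?_ ?_ (by simp only [NExp.cost]; omega)) ?_ le_rfl
    · intro s'' hf'
      simp only [NExp.eval]
      rw [hf'.1 0 (by decide), hf₂.1 0 (by decide), hn']
    · simpa [State.setNat, State.setReal] using i6
    · rintro l hl s'' hf' hcnt' ⟨j6, j6'⟩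
      have hread' : ∀ a ∈ [0, 1, 2, 3, 4, 5], s''.real a = s.real a := by
        intro a ha
        rw [hf'.2 a (by revert a; decide), hf₂.2 a (by revert a; decide), hread a ha]
      have h9 : s''.nat 9 0 = m * n := by rw [hf'.1 9 (by decide), hf₂.1 9 (by decide), i9]
      have h12 : s''.nat 12 0 = m := by rw [hf'.1 12 (by decide), hf₂.1 12 (by decide), hcnt]
      refine Cmd.Ensures.setReal (by simp [NExp.cost, RExp.cost])
        ⟨fun i hi j hj => ?_, fun j hj => ?_⟩
      · have hlt : i * n + j < m * n + l := by
          calc i * n + j < i * n + n := by omega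
            _ = (i + 1) * n := by ring
            _ ≤ m * n := Nat.mul_le_mul_right _ hi
            _ ≤ _ := Nat.le_add_right _ _
        simpa [State.setNat, State.setReal, NExp.eval, h9, hcnt', hlt.ne] using j6 i hi j hj
      · by_cases h : j = l
        · subst h
          simp [State.setNat, State.setReal, NExp.eval, RExp.eval, h9, hcnt', h12,
            hread' 0 (by decide), hread' 1 (by decide), hread' 4 (by decide),
            hread' 5 (by decide), translatesIntervals]
        · simpa [State.setNat, State.setReal, NExp.eval, h9, hcnt', h] using j6' j (by omega)
    · rintro s₃ hf₃ ⟨j6, j6'⟩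
      have h9 : s₃.nat 9 0 = m * n := by rw [hf₃.1 9 (by decide), hf₂.1 9 (by decide), i9]
      have h0 : s₃.nat 0 0 = n := by rw [hf₃.1 0 (by decide), hf₂.1 0 (by decide), hn']
      have h7 : ∀ i, s₃.real 7 i = if i = m then s.real 3 m - s.real 2 m else s'.real 7 i := by
        intro i
        rw [hf₃.2 7 (by decide)]
        simp [State.setReal, Function.update_apply]
      refine Cmd.Ensures.setNat (by simp [NExp.cost]) ⟨?_, fun i hi => ?_, fun i hi j hj => ?_⟩
      · simp [State.setNat, NExp.eval, h9, h0]
        ring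
      · simp only [State.setNat, h7]
        split_ifs with h
        · rw [h]
          rfl
        · exact i7 i (by omega)
      · simp only [State.setNat]
        rcases Nat.lt_succ_iff_lt_or_eq.1 hi with hi | rfl
        · exact j6 i hi j hj
        · exact j6' j hj
  · simp only [NExp.cost]
    exact Nat.add_le_add (Nat.mul_le_mul_left _ (by omega)) (by omega)
  · rintro s' hf ⟨-, h7, h6⟩
    constructor
    · rw [hf.1 0 (by decide), hf₁.1 0 (by decide), hn]
    · rw [hf.1 1 (by decide), hf₁.1 1 (by decide), hk]
    · rw [hf.1 2 (by decide), hf₁.1 2 (by decide), hc]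
    · rw [hf.1 3 (by decide), hf₁.1 3 (by decide), hr]
    · exact h6
    · exact h7

/-- Compute the keys and widths of a set of axis-parallel unit squares. -/
def loadSquares : Cmd :=
  .seq (.setNat 2 (.const 0) (.const 1))
    (.seq (.setNat 3 (.const 0) (.const 2))
      (.seq (.setReal 7 (.const 0) (.const 1))
        (.seq (.setReal 7 (.const 1) (.const 1))
          (.forTo 7 (.var 0)
            (.seq (.setReal 6 (.var 7) (.read 1 (.var 7)))
              (.setReal 6 (.add (.var 0) (.var 7)) (.sub (.const 0) (.read 0 (.var 7)))))))))

/-- The projections of unit squares, given by the coordinates of their lower left corners. -/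
def squaresIntervals (s : State) : Intervals where
  key i j := if i = 0 then s.real 1 j else - s.real 0 j
  w _ := 1

theorem loadSquares_ensures {s : State} {n k : ℕ} (hn : s.nat 0 0 = n) (hk : s.nat 1 0 = k) :
    loadSquares.Ensures s (100 * (n + 1)) (Loaded (squaresIntervals s) n k 1 2) := by
  obtain ⟨s₁, hs₁⟩ : ∃ s₁, s₁ = (((s.setNat 2 0 1).setNat 3 0 2).setReal 7 0 1).setReal 7 1 1 :=
    ⟨_, rfl⟩
  have hn₁ : s₁.nat 0 0 = n := by simpa [hs₁, State.setNat, State.setReal] using hn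
  have hk₁ : s₁.nat 1 0 = k := by simpa [hs₁, State.setNat, State.setReal] using hk
  have h0 : s₁.real 0 = s.real 0 := by simp [hs₁, State.setNat, State.setReal]
  have h1 : s₁.real 1 = s.real 1 := by simp [hs₁, State.setNat, State.setReal]
  obtain ⟨t, s₂, hrun, ht, hl⟩ : (Cmd.forTo 7 (.var 0)
      (.seq (.setReal 6 (.var 7) (.read 1 (.var 7)))
        (.setReal 6 (.add (.var 0) (.var 7)) (.sub (.const 0) (.read 0 (.var 7)))))).Ensures s₁
      (50 * (n + 1)) (Loaded (squaresIntervals s) n k 1 2) := by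
    refine (Cmd.Ensures.forTo (n := n) (T := 30) (fun m s' => ∀ j < m,
      s'.real 6 j = s.real 1 j ∧ s'.real 6 (n + j) = - s.real 0 j) (by decide) ?_ (by simp)
        ?_ le_rfl).mono (by simp only [NExp.cost]; omega) ?_
    · intro s' hf
      simp only [NExp.eval]
      rw [hf.1 0 (by decide), hn₁]
    · intro m hm s' hf hcnt hinv
      have h0' : s'.real 0 = s.real 0 := by rw [hf.2 0 (by decide), h0]
      have h1' : s'.real 1 = s.real 1 := by rw [hf.2 1 (by decide), h1]
      have hn' : s'.nat 0 0 = n := by rw [hf.1 0 (by decide), hn₁]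
      refine ⟨_, _, Run.seq (Run.setReal _ _ _ _) (Run.setReal _ _ _ _),
        by simp [NExp.cost, RExp.cost], fun j hj => ?_⟩
      by_cases h : j = m
      · subst h
        simp [State.setNat, State.setReal, NExp.eval, RExp.eval, hcnt, h0', h1', hn',
          show n ≠ 0 by omega]
      · have := hinv j (by omega)
        simpa [State.setNat, State.setReal, NExp.eval, RExp.eval, hcnt, h0', h1', hn', h,
          Function.update_apply, show j ≠ n + m by omega, show n + j ≠ m by omega] using this
    · intro s' hf h
      constructor
      · rw [hf.1 0 (by decide), hn₁]
      · rw [hf.1 1 (by decide), hk₁]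
      · rw [hf.1 2 (by decide)]
        simp [hs₁, State.setNat, State.setReal]
      · rw [hf.1 3 (by decide)]
        simp [hs₁, State.setNat, State.setReal]
      · intro i hi j hj
        interval_cases i
        · simpa [squaresIntervals] using (h j hj).1
        · simpa [squaresIntervals] using (h j hj).2
      · intro i hi
        rw [hf.2 7 (by decide)]
        interval_cases i <;> simp [hs₁, State.setNat, State.setReal, squaresIntervals]
  refine ⟨_, s₂, Run.seq (Run.setNat _ _ _ _) (Run.seq (Run.setNat _ _ _ _) (Run.seq
    (Run.setReal _ _ _ _) (Run.seq (Run.setReal _ _ _ _) (?_ : Run _ _ t s₂)))), ?_, hl⟩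
  · rw [hs₁] at hrun
    simpa [NExp.eval, RExp.eval] using hrun
  · simp only [NExp.cost, RExp.cost]
    omega

theorem unitSquare_eq_translate (a : Plane) : unitSquare a = translate (unitSquare 0) a := by
  ext x
  constructor
  · intro h
    refine ⟨x - a, fun i => ?_, by simp⟩
    have := h i
    simp only [PiLp.zero_apply, PiLp.sub_apply]
    constructor <;> linarith [this.1, this.2]
  · rintro ⟨y, hy, rfl⟩ i
    have := hy i
    simp only [PiLp.zero_apply, PiLp.add_apply] at this ⊢
    constructor <;> linarith [this.1, this.2]

theorem isConnected_unitSquare : IsConnected (unitSquare 0) := by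
  have hconv : Convex ℝ (unitSquare 0) := by
    intro x hx y hy a b ha hb hab i
    have h1 := hx i
    have h2 := hy i
    simp only [PiLp.zero_apply, PiLp.add_apply, PiLp.smul_apply, smul_eq_mul] at *
    constructor <;> nlinarith [h1.1, h1.2, h2.1, h2.2]
  exact hconv.isConnected ⟨0, fun i => by simp⟩

/-- Direction vectors of the axis-parallel lines. -/
noncomputable def axes : Fin 2 → Plane := ![!₂[(1 : ℝ), 0], !₂[(0 : ℝ), 1]]

theorem axisParallel_eq : axisParallel = directions axes := by
  ext D
  simp [axisParallel, directions, axes, Fin.exists_fin_two, eq_comm]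

theorem axes_ne_zero (i : Fin 2) : axes i ≠ 0 := by
  intro h
  have h0 := congrArg (fun x : Plane => x 0) h
  have h1 := congrArg (fun x : Plane => x 1) h
  fin_cases i <;> simp [axes] at h0 h1

theorem level_axes_zero (x : Plane) : level (axes 0) x = x 1 := by simp [level, axes]

theorem level_axes_one (x : Plane) : level (axes 1) x = - x 0 := by simp [level, axes]

theorem isLeast_level_axes (i : Fin 2) :
    IsLeast (level (axes i) '' unitSquare 0) ((![0, -1] : Fin 2 → ℝ) i) := by
  fin_cases i
  · refine ⟨⟨0, fun i => by simp, by simp [level]⟩, ?_⟩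
    rintro _ ⟨x, hx, rfl⟩
    have := (hx 1).1
    simpa [level_axes_zero] using this
  · refine ⟨⟨!₂[1, 1], fun i => by fin_cases i <;> simp, by simp [level_axes_one]⟩, ?_⟩
    rintro _ ⟨x, hx, rfl⟩
    have := (hx 0).2
    simpa [level_axes_one] using this

theorem isGreatest_level_axes (i : Fin 2) :
    IsGreatest (level (axes i) '' unitSquare 0) ((![1, 0] : Fin 2 → ℝ) i) := by
  fin_cases i
  · refine ⟨⟨!₂[1, 1], fun i => by fin_cases i <;> simp, by simp [level_axes_zero]⟩, ?_⟩
    rintro _ ⟨x, hx, rfl⟩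
    have := (hx 1).2
    simpa [level_axes_zero] using this
  · refine ⟨⟨0, fun i => by simp, by simp [level]⟩, ?_⟩
    rintro _ ⟨x, hx, rfl⟩
    have := (hx 0).1
    simpa [level_axes_one] using this

/-- A horizontal and a vertical line have a common point, and hit at most one of several disjoint
squares. -/
theorem shallow_squares {n : ℕ} {a : Fin n → Plane}
    (h : Pairwise fun i j => Disjoint (unitSquare (a i)) (unitSquare (a j))) {I : Intervals}
    (hkey : ∀ (i : Fin 2) (j : Fin n), I.key i j = level (axes i) (a j)) (hw : ∀ i, I.w i = 1) :
    I.Shallow 2 1 (Finset.range n) := by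
  classical
  have key : ∀ u u' : ℝ, ∀ j : Fin n, I.Hits (0, u) j → I.Hits (1, u') j →
      !₂[-u', u + 1] ∈ unitSquare (a j) := by
    intro u u' j h0 h1
    have k0 := hkey 0 j
    have k1 := hkey 1 j
    rw [level_axes_zero] at k0
    rw [level_axes_one] at k1
    simp only [Intervals.Hits, hw] at h0 h1
    simp only [Fin.val_zero, Fin.val_one] at k0 k1
    rw [k0] at h0
    rw [k1] at h1
    intro i
    fin_cases i
    · simp
      constructor <;> linarith [h1.1, h1.2]
    · simp
      constructor <;> linarith [h0.1, h0.2]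
  have huniq : ∀ x : Plane, ∀ j j' : Fin n, x ∈ unitSquare (a j) → x ∈ unitSquare (a j') →
      j = j' := by
    intro x j j' hj hj'
    by_contra hne
    exact Set.disjoint_left.1 (h hne) hj hj'
  rintro ⟨i, u⟩ ⟨i', u'⟩ hi hi' hne
  refine Finset.card_le_one.2 fun j hj j' hj' => ?_
  rw [Finset.mem_filter, Finset.mem_range] at hj hj'
  obtain ⟨hj, h1, h2⟩ := hj
  obtain ⟨hj', h1', h2'⟩ := hj'
  simp only at hi hi' hne
  have hcases : (i = 0 ∧ i' = 1) ∨ (i = 1 ∧ i' = 0) := by omega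
  rcases hcases with ⟨rfl, rfl⟩ | ⟨rfl, rfl⟩
  · exact congrArg Fin.val (huniq _ ⟨j, hj⟩ ⟨j', hj'⟩ (key u u' _ h1 h2) (key u u' _ h1' h2'))
  · exact congrArg Fin.val (huniq _ ⟨j, hj⟩ ⟨j', hj'⟩ (key u' u _ h2 h1) (key u' u _ h2' h1'))

/-- A program which is run after the keys have been loaded answers the question. -/
theorem answers_of_loaded {load : Cmd} {s : State} {n k c r T : ℕ} {I : Intervals} {Q : Prop}
    (hload : load.Ensures s T (Loaded I n k c r)) (h5 : ∀ e, s.nat 5 e = 0)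
    (h14 : s.nat 14 0 = 0) (hw5 : 5 ∉ load.natWrites) (hw14 : 14 ∉ load.natWrites)
    (hr : 1 ≤ r) (hc : 1 ≤ c) (hw : ∀ i < r, 0 ≤ I.w i) (hsh : I.Shallow r c (Finset.range n))
    (hQ : Q ↔ I.Coverable r (Finset.range n) k) :
    ∃ t, (Cmd.seq load decideCoverable).Answers s Q t ∧
      t ≤ T + 1000 * ((16 * (r * c)) ^ k * k.factorial ^ 2 *
        ((n + 1) * (r + 4 * k + 4 * (c * k) + 5) * (k + 1))) := by
  classical
  obtain ⟨t, s', hrun, ht, hs'⟩ := Cmd.Ensures.seq (q := decideCoverable) hload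
    (fun s₁ hf hl => decideCoverable_ensures hl hr hc hw hsh
      (by rw [hf.1 5 hw5]; exact h5) (by rw [hf.1 14 hw14]; exact h14)) le_rfl
  rw [Intervals.prod_choices] at ht
  refine ⟨t, ⟨s', hrun, fun h => ?_, fun h => ?_⟩, ht⟩
  · rw [hs', if_pos (hQ.1 h)]
  · rw [hs', if_neg fun h' => h (hQ.2 h')]

theorem mulFree_stabSquares : (Cmd.seq loadSquares decideCoverable).MulFree := by
  simp [loadSquares, decideCoverable, storeChoices, search, evaluate, checkMarks, advance,
    applyCandidate, pickItem, computeBase, startKey, candidateKey, stepKey, markHits, currentKey,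
    Cmd.forTo, Cmd.MulFree, BExp.MulFree, RExp.MulFree]

theorem getD_ofFn {n : ℕ} (f : Fin n → ℝ) (j : Fin n) : (List.ofFn f).getD j 0 = f j := by
  simp

theorem primrec_factorial : Primrec Nat.factorial := by
  refine (Primrec.nat_rec₁ (f := fun n m => (n + 1) * m) 1
    (Primrec.nat_mul.comp₂ (Primrec.succ.comp₂ Primrec₂.left) Primrec₂.right)).of_eq fun n => ?_
  induction n with
  | zero => rfl
  | succ n ih => rw [Nat.factorial_succ, ← ih]

theorem primrec_pow : Primrec₂ ((· ^ ·) : ℕ → ℕ → ℕ) := Primrec₂.unpaired'.1 Nat.Primrec.pow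

theorem fixedParameterTractable_disjointUnitSquares :
    FixedParameterTractable disjointUnitSquares := by
  refine ⟨.seq loadSquares decideCoverable, mulFree_stabSquares,
    fun k => 100 + 1000 * (32 ^ k * k.factorial ^ 2 * ((8 * k + 7) * (k + 1))), ?_, 1, ?_⟩
  · have h1 : Primrec fun k : ℕ => k + 1 := Primrec.succ
    have h2 : Primrec fun k : ℕ => 8 * k + 7 :=
      Primrec.nat_add.comp (Primrec.nat_mul.comp (Primrec.const 8) .id) (Primrec.const 7)
    have h3 : Primrec fun k : ℕ => 32 ^ k * k.factorial ^ 2 :=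
      Primrec.nat_mul.comp (primrec_pow.comp (Primrec.const 32) .id)
        (primrec_pow.comp primrec_factorial (Primrec.const 2))
    exact (Primrec.nat_add.comp (Primrec.const 100) (Primrec.nat_mul.comp (Primrec.const 1000)
      (Primrec.nat_mul.comp h3 (Primrec.nat_mul.comp h2 h1)))).to_comp
  · rintro ⟨n, k, a, hdisj⟩
    set s := disjointUnitSquares.input ⟨n, k, a, hdisj⟩ with hs
    have hkey : ∀ (i : Fin 2) (j : Fin n),
        (squaresIntervals s).key i j = level (axes i) (a j) := by
      intro i j
      have h0 : s.real 0 j = a j 0 := getD_ofFn (fun j => a j 0) j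
      have h1 : s.real 1 j = a j 1 := getD_ofFn (fun j => a j 1) j
      fin_cases i
      · simpa [squaresIntervals, level_axes_zero] using h1
      · simpa [squaresIntervals, level_axes_one] using h0
    obtain ⟨t, hans, ht⟩ := answers_of_loaded (k := k)
      (Q := Stabbable axisParallel (fun j => unitSquare (a j)) k)
      (loadSquares_ensures (s := s) (n := n) (k := k) rfl rfl)
      (fun e => by simp [hs, disjointUnitSquares, State.init]) rfl (by decide) (by decide)
      (by norm_num) le_rfl (fun i _ => zero_le_one) (shallow_squares hdisj hkey fun _ => rfl) (by
        rw [axisParallel_eq]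
        simp only [unitSquare_eq_translate (a _)]
        refine stabbable_iff_coverable (lo := ![0, -1]) (hi := ![1, 0]) axes_ne_zero
          isConnected_unitSquare isLeast_level_axes isGreatest_level_axes hkey (fun i => ?_) k
        fin_cases i <;> simp [squaresIntervals])
    refine ⟨t, hans, ht.trans (le_of_eq ?_)⟩
    simp only [disjointUnitSquares]
    ring

theorem two_mul_pow_self_le {k : ℕ} (hk : 1 ≤ k) : 2 * k ^ k ≤ (k + 1) ^ k := by
  have key : ∀ m, k ^ m * (k + m) ≤ (k + 1) ^ m * k := by
    intro m
    induction m with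
    | zero => simp
    | succ m ih =>
      calc k ^ (m + 1) * (k + (m + 1)) ≤ k ^ (m + 1) * (k + (m + 1)) + k ^ m * m :=
            Nat.le_add_right _ _
        _ = k ^ m * (k + m) * (k + 1) := by ring
        _ ≤ (k + 1) ^ m * k * (k + 1) := Nat.mul_le_mul_right _ ih
        _ = _ := by ring
  refine Nat.le_of_mul_le_mul_right ?_ hk
  calc 2 * k ^ k * k = k ^ k * (k + k) := by ring
    _ ≤ _ := key k

theorem two_pow_mul_factorial_le {k : ℕ} (hk : 1 ≤ k) : 2 ^ k * k.factorial ≤ 2 * k ^ k := by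
  induction k, hk using Nat.le_induction with
  | base => norm_num
  | succ k hk ih =>
    have h := two_mul_pow_self_le hk
    calc 2 ^ (k + 1) * (k + 1).factorial = 2 * (k + 1) * (2 ^ k * k.factorial) := by
          rw [Nat.factorial_succ]
          ring
      _ ≤ 2 * (k + 1) * (2 * k ^ k) := Nat.mul_le_mul_left _ ih
      _ ≤ 2 * (k + 1) * (k + 1) ^ k := Nat.mul_le_mul_left _ h
      _ = _ := by ring

theorem combinations_le {r c k : ℕ} (hr : 1 ≤ r) (hc : 1 ≤ c) (hk : 1 ≤ k) :
    (16 * (r * c)) ^ k * k.factorial ^ 2 ≤ 4 * (2 * r * c * k) ^ (2 * k) := by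
  have h1 : 1 ≤ r * c := Nat.mul_pos hr hc
  have h2 : (16 * (r * c)) ^ k = (4 * (r * c)) ^ k * (2 ^ k) ^ 2 := by
    rw [← pow_mul, mul_comm k 2, pow_mul, ← mul_pow]
    congr 1
    ring
  have h3 : (4 * (r * c * (r * c))) ^ k * (k ^ k) ^ 2 = (2 * r * c * k) ^ (2 * k) := by
    rw [pow_mul _ 2 k, ← pow_mul k k 2, mul_comm k 2, pow_mul k 2 k, ← mul_pow]
    congr 1
    ring
  calc (16 * (r * c)) ^ k * k.factorial ^ 2
      = (4 * (r * c)) ^ k * (2 ^ k * k.factorial) ^ 2 := by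
        rw [h2]
        ring
    _ ≤ (4 * (r * c * (r * c))) ^ k * (2 * k ^ k) ^ 2 :=
        Nat.mul_le_mul
          (Nat.pow_le_pow_left (Nat.mul_le_mul_left _ (Nat.le_mul_of_pos_left _ h1)) _)
          (Nat.pow_le_pow_left (two_pow_mul_factorial_le hk) _)
    _ = 4 * (2 * r * c * k) ^ (2 * k) := by
        rw [← h3]
        ring

theorem steps_le {n k c r t : ℕ} (hk : 1 ≤ k) (hc : 1 ≤ c) (hr : 1 ≤ r)
    (ht : t ≤ 100 * ((r + 1) * (n + 1)) + 1000 * ((16 * (r * c)) ^ k * k.factorial ^ 2 *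
      ((n + 1) * (r + 4 * k + 4 * (c * k) + 5) * (k + 1)))) :
    t ≤ 30000 * ((2 * r * c * k) ^ (2 * k + 2) * (n + 1)) := by
  set X := 2 * r * c * k with hX
  have hrck : r ≤ r * c * k := by
    rw [mul_assoc]
    exact Nat.le_mul_of_pos_right _ (Nat.mul_pos hc hk)
  have hkrc : k ≤ r * c * k := Nat.le_mul_of_pos_left _ (Nat.mul_pos hr hc)
  have hckr : c * k ≤ r * c * k := by
    rw [mul_assoc]
    exact Nat.le_mul_of_pos_left _ hr
  have hX2 : X = 2 * (r * c * k) := by rw [hX]; ring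
  have hX1 : 2 ≤ X := by omega
  have h1 : (r + 4 * k + 4 * (c * k) + 5) * (k + 1) ≤ 7 * X ^ 2 := by
    calc (r + 4 * k + 4 * (c * k) + 5) * (k + 1) ≤ (7 * X) * X := by
          gcongr <;> omega
      _ = _ := by ring
  have h2 : r + 1 ≤ X ^ (2 * k + 2) := by
    calc r + 1 ≤ X ^ 1 := by rw [pow_one]; omega
      _ ≤ _ := Nat.pow_le_pow_right (by omega) (by omega)
  calc t ≤ _ := ht
    _ = 100 * ((r + 1) * (n + 1)) + 1000 * ((16 * (r * c)) ^ k * k.factorial ^ 2 *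
      (((r + 4 * k + 4 * (c * k) + 5) * (k + 1)) * (n + 1))) := by ring
    _ ≤ 100 * (X ^ (2 * k + 2) * (n + 1)) + 1000 * (4 * X ^ (2 * k) * (7 * X ^ 2 * (n + 1))) := by
        have h3 := combinations_le hr hc hk
        gcongr
    _ = 28100 * (X ^ (2 * k + 2) * (n + 1)) := by ring
    _ ≤ _ := by gcongr; norm_num

end Stabbing

theorem theorem5 :
    RealRAM.FixedParameterTractable Stabbing.disjointUnitSquares ∧
    ∃ (p : RealRAM.Cmd) (C : ℝ),
      ∀ (n k c r : ℕ) (d : Fin r → Stabbing.Plane) (O : Set Stabbing.Plane)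
        (lo hi : Fin r → ℝ) (v : Fin n → Stabbing.Plane),
        1 ≤ k → 1 ≤ c → 1 ≤ r →
        (∀ i, d i ≠ 0) →
        Function.Injective (fun i => Submodule.span ℝ {d i}) →
        IsCompact O → IsConnected O →
        (∀ i, IsLeast (Stabbing.level (d i) '' O) (lo i)) →
        (∀ i, IsGreatest (Stabbing.level (d i) '' O) (hi i)) →
        Stabbing.Shallow c (Stabbing.directions d) (fun j => Stabbing.translate O (v j)) →
        ∃ t : ℕ,
          p.Answers (Stabbing.translatesInput n k c r d lo hi v)
            (Stabbing.Stabbable (Stabbing.directions d)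
              (fun j => Stabbing.translate O (v j)) k) t ∧
          (2 ≤ n → (t : ℝ) ≤
            C * (2 * r * c * k : ℝ) ^ (2 * k + 2) * r * (n * Real.log n)) := by
  refine ⟨Stabbing.fixedParameterTractable_disjointUnitSquares,
    .seq Stabbing.loadTranslates Stabbing.decideCoverable, 120000, ?_⟩
  intro n k c r d O lo hi v hk hc hr hd hinj _ hO hlo hhi hsh
  set s := Stabbing.translatesInput n k c r d lo hi v with hs
  have hkey : ∀ (i : Fin r) (j : Fin n),
      (Stabbing.translatesIntervals s).key i j = Stabbing.level (d i) (v j) := by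
    intro i j
    have h0 : s.real 0 i = d i 0 := Stabbing.getD_ofFn (fun i => d i 0) i
    have h1 : s.real 1 i = d i 1 := Stabbing.getD_ofFn (fun i => d i 1) i
    have h4 : s.real 4 j = v j 0 := Stabbing.getD_ofFn (fun j => v j 0) j
    have h5 : s.real 5 j = v j 1 := Stabbing.getD_ofFn (fun j => v j 1) j
    simp only [Stabbing.translatesIntervals, h0, h1, h4, h5, Stabbing.level]
  have hw : ∀ i : Fin r, (Stabbing.translatesIntervals s).w i = hi i - lo i := by
    intro i
    have h2 : s.real 2 i = lo i := Stabbing.getD_ofFn lo i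
    have h3 : s.real 3 i = hi i := Stabbing.getD_ofFn hi i
    simp only [Stabbing.translatesIntervals, h2, h3]
  obtain ⟨t, hans, ht⟩ := Stabbing.answers_of_loaded (k := k)
    (Stabbing.loadTranslates_ensures (s := s) (n := n) (k := k) (c := c) (r := r) rfl rfl rfl rfl)
    (fun e => by simp [hs, Stabbing.translatesInput, RealRAM.State.init]) rfl (by decide)
    (by decide) hr hc
    (fun i hir => by
      rw [hw ⟨i, hir⟩]
      exact sub_nonneg.2 ((hlo _).2 (hhi _).1))
    (hsh.intervals hd hinj hO hlo hhi hkey hw)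
    (Stabbing.stabbable_iff_coverable hd hO hlo hhi hkey hw k)
  refine ⟨t, hans, fun hn => ?_⟩
  have h1 : (t : ℝ) ≤ 30000 * ((2 * r * c * k : ℝ) ^ (2 * k + 2) * (n + 1)) := by
    exact_mod_cast Stabbing.steps_le hk hc hr ht
  have hn' : (2 : ℝ) ≤ n := by exact_mod_cast hn
  have hlog : 1 / 2 ≤ Real.log n :=
    le_trans (by linarith [Real.log_two_gt_d9]) (Real.log_le_log (by norm_num) hn')
  have h2 : (n + 1 : ℝ) ≤ 4 * (n * Real.log n) := by nlinarith
  have hr' : (1 : ℝ) ≤ r := by exact_mod_cast hr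
  have hX : (0 : ℝ) ≤ (2 * r * c * k : ℝ) ^ (2 * k + 2) := by positivity
  calc (t : ℝ) ≤ 30000 * ((2 * r * c * k : ℝ) ^ (2 * k + 2) * (n + 1)) := h1
    _ ≤ 30000 * ((2 * r * c * k : ℝ) ^ (2 * k + 2) * (4 * (n * Real.log n))) := by gcongr
    _ = 120000 * (2 * r * c * k : ℝ) ^ (2 * k + 2) * 1 * (n * Real.log n) := by ring
    _ ≤ _ := by gcongr
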